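/- Let $\mathcal H$ be a finite-dimensional complex Hilbert space (inner product antilinear in the first variable) with an antiunitary involution $\mathfrak A$, i.e. $\mathfrak A$ is antilinear, $\mathfrak A^2=1$ and $\langle\mathfrak A\varphi_1,\mathfrak A\varphi_2\rangle=\langle\varphi_2,\varphi_1\rangle$. Let $P$ be a basis projection, i.e. an orthogonal projection on $\mathcal H$ with $\mathfrak AP\mathfrak A=1-P$, put $\mathfrak h_P=\operatorname{ran}P$, and let $\psi_1,\dots,\psi_n$ be an orthonormal basis of $\mathfrak h_P$. For $N\in\mathbb N_0$ let $\mathcal H^{(0)},\dots,\mathcal H^{(N)}$ be copies of $\mathcal H$, write $\varphi^{(q)}$ for the copy of $\varphi\in\mathcal H$ in $\mathcal H^{(q)}$, and let $\mathcal G=\wedge^*\big(\bigoplus_{q=0}^N\mathcal H^{(q)}\big)$ be the complex Grassmann algebra, with the involution $*$ that is antilinear, satisfies $1^*=1$ and $(\xi\wedge\zeta)^*=\zeta^*\wedge\xi^*$, and maps $\varphi^{(q)}$ to $(\mathfrak A\varphi)^{(q)}$. *Circle product.* For $k\in\{0,\dots,N\}$ adjoin one further copy $\mathcal H^{(\mathrm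 a)}$ of $\mathcal H$. For an orthonormal basis $\chi_1,\dots,\chi_n$ of $\mathfrak h_P$ let $\langle\mathfrak h_P^{(p)},\mathfrak h_P^{(q)}\rangle=\sum_j(\mathfrak A\chi_j)^{(p)}\wedge\chi_j^{(q)}$ and let $\int_P\mathrm d(\mathcal H^{(\mathrm a)})=\prod_{j}\frac{\delta}{\delta\chi_j^{(\mathrm a)}}\frac{\delta}{\delta(\mathfrak A\chi_j)^{(\mathrm a)}}$ be the Berezin integral, where $\delta/\delta\varphi^{(\mathrm a)}$ is the antiderivation that sends $\tilde\varphi^{(\mathrm a)}$ to $\langle\varphi,\tilde\varphi\rangle$ and the other copies to $0$. For $\xi,\zeta\in\mathcal G$ define $$\xi\circ_P^{(k)}\zeta=(-1)^{\frac{\dim\mathcal H}{2}}\int_P\mathrm d(\mathcal H^{(\mathrm a)})\;\varkappa'(\xi)\,\varkappa''(\zeta)\,e^{-\langle\mathfrak h_P^{(k)},\mathfrak h_P^{(k)}\rangle}e^{\langle\mathfrak h_P^{(k)},\mathfrak h_P^{(\mathrm a)}\rangle}e^{-\langle\mathfrak h_P^{(\mathrm a)},\mathfrak h_P^{(\mathrm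 a)}\rangle}e^{\langle\mathfrak h_P^{(\mathrm a)},\mathfrak h_P^{(k)}\rangle},$$ with exterior products and exponentials on the right-hand side, where $\varkappa'$ and $\varkappa''$ are the homomorphisms of Grassmann algebras that leave the copies other than $k$ in place and satisfy, for $\varphi\in\mathfrak h_P$, $\varkappa'(\varphi^{(k)})=\varphi^{(\mathrm a)}$, $\varkappa'((\mathfrak A\varphi)^{(k)})=(\mathfrak A\varphi)^{(k)}$, $\varkappa''(\varphi^{(k)})=\varphi^{(k)}$, $\varkappa''((\mathfrak A\varphi)^{(k)})=(\mathfrak A\varphi)^{(\mathrm a)}$. The statement holds for every choice of the basis $(\chi_j)$, which need not be $(\psi_j)$. *Displacement operators.* Let $\boldsymbol\psi^{(q)}=(\psi_1^{(q)},(\mathfrak A\psi_1)^{(q)},\dots,\psi_n^{(q)},(\mathfrak A\psi_n)^{(q)})^{\mathrm T}$, $\mathcal J=\begin{pmatrix}0&1\\1&0\end{pmatrix}^{\oplus n}$, and $(x,\mathcal Jy)=x^{\mathrm T}\mathcal Jy$ with entries multiplied by $\wedge$. For $x\in\mathcal G^{2n}$ put $$\mathbb T_k(x)=\exp\!\big(-(x,\mathcal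 J\boldsymbol\psi^{(k)})\big),$$ where, here and below, $\exp(a)=1+\sum_{r\ge1}a^r/r!$ with powers taken for the product $\circ_P^{(k)}$. **Lemma.** Let $k,l,m\in\{0,\dots,N\}$ with $k\ne l$ and $k\ne m$. Then, for every $i\in\{1,\dots,n\}$, $$\mathbb T_k(\boldsymbol\psi^{(l)})^*\circ_P^{(k)}\psi_i^{(k)}\circ_P^{(k)}\mathbb T_k(\boldsymbol\psi^{(l)})=\psi_i^{(k)}+\psi_i^{(l)},$$ $$\mathbb T_k(\boldsymbol\psi^{(l)})^*\circ_P^{(k)}(\mathfrak A\psi_i)^{(k)}\circ_P^{(k)}\mathbb T_k(\boldsymbol\psi^{(l)})=(\mathfrak A\psi_i)^{(k)}+(\mathfrak A\psi_i)^{(l)};$$ thus, entrywise, $\mathbb T_k(\boldsymbol\psi^{(l)})^*\circ_P^{(k)}\boldsymbol\psi^{(k)}\circ_P^{(k)}\mathbb T_k(\boldsymbol\psi^{(l)})=\boldsymbol\psi^{(k)}+\boldsymbol\psi^{(l)}$. Moreover $$\mathbb T_k(\boldsymbol\psi^{(l)}+\boldsymbol\psi^{(m)})=\mathbb T_k(\boldsymbol\psi^{(l)})\circ_P^{(k)}\mathbb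 T_k(\boldsymbol\psi^{(m)})\circ_P^{(k)}\exp\!\Big(+\tfrac12\big(\boldsymbol\psi^{(l)},\mathcal J\boldsymbol\psi^{(m)}\big)\Big).$$ -/

import Mathlib

noncomputable section

namespace GrassmannWeyl

/-- `A` is an antiunitary involution, i.e. `(H, A)` is a self-dual Hilbert space. -/
structure IsSelfDual {H : Type*} [NormedAddCommGroup H] [InnerProductSpace ℂ H]
    (A : H →ₗ⋆[ℂ] H) : Prop where
  involutive : ∀ x, A (A x) = x
  inner_map : ∀ x y, inner ℂ (A x) (A y) = inner ℂ y x

/-- `P` is a basis projection of `(H, A)`: an orthogonal projection with `A P A = 1 - P`. -/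
structure IsBasisProjection {H : Type*} [NormedAddCommGroup H] [InnerProductSpace ℂ H]
    (A : H →ₗ⋆[ℂ] H) (P : H →ₗ[ℂ] H) : Prop where
  isSymmetricProjection : P.IsSymmetricProjection
  conj_eq : ∀ x, A (P (A x)) = x - P x

/-- The Grassmann algebra of the direct sum of copies `H^(q)` of `H`, indexed by `q : ι`. -/
abbrev Grassmann (ι H : Type*) [AddCommGroup H] [Module ℂ H] : Type _ :=
  ExteriorAlgebra ℂ (ι → H)

section Basic

variable {ι H : Type*} [DecidableEq ι] [NormedAddCommGroup H] [InnerProductSpace ℂ H]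

/-- The copy `φ^(q)` of the vector `φ`, as an element of degree one. -/
def copy (q : ι) (φ : H) : Grassmann ι H :=
  ExteriorAlgebra.ι ℂ (Pi.single q φ)

/-- The exponential series `∑ xⁿ / n!`, where the powers are those of the product `mul`; the sum
is taken in the canonical topology of a complex vector space (the module topology). -/
def expSeries (mul : Grassmann ι H → Grassmann ι H → Grassmann ι H) (x : Grassmann ι H) :
    Grassmann ι H :=
  letI : TopologicalSpace (Grassmann ι H) := moduleTopology ℂ (Grassmann ι H)
  ∑' n : ℕ, ((n.factorial : ℂ)⁻¹) • (mul x)^[n] 1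

/-- The exponential for the exterior product. -/
def wedgeExp (x : Grassmann ι H) : Grassmann ι H :=
  expSeries (fun ξ ζ => ξ * ζ) x

/-- The Berezin derivative `δ/δφ^(q)`: the antiderivation of the Grassmann algebra that sends a
degree one element `v` to the scalar `⟨φ, v_q⟩`. -/
def berezinDeriv (q : ι) (φ : H) : Module.End ℂ (Grassmann ι H) :=
  CliffordAlgebra.contractLeft ((innerₛₗ ℂ φ) ∘ₗ (LinearMap.proj q : (ι → H) →ₗ[ℂ] H))

variable (A : H →ₗ⋆[ℂ] H) {P : H →ₗ[ℂ] H} {n : ℕ}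
  (χ : OrthonormalBasis (Fin n) ℂ (LinearMap.range P))

/-- The Berezin integral over the copy `H^(q)`, the product over `j` of
`(δ/δχ_j^(q)) (δ/δ(Aχ_j)^(q))`. -/
def berezinIntegral (q : ι) : Module.End ℂ (Grassmann ι H) :=
  (List.ofFn fun j : Fin n => berezinDeriv q (χ j : H) * berezinDeriv q (A (χ j : H))).prod

/-- The element `⟨𝔥_P^(p), 𝔥_P^(q)⟩ = ∑_j (Aχ_j)^(p) ∧ χ_j^(q)`. -/
def bilin (p q : ι) : Grassmann ι H :=
  ∑ j : Fin n, copy p (A (χ j : H)) * copy q (χ j : H)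

end Basic

section Circle

variable {ι H : Type*} [Fintype ι] [DecidableEq ι]
  [NormedAddCommGroup H] [InnerProductSpace ℂ H]

/-- The relabelling of copies `ϰ_{(k,k)}^{(a,b)}`: on the copy `k`, the part in `ran (1 - P)` (which
is `A (ran P)`) is moved to the copy `a` and the part in `ran P` to the copy `b`; all the other
copies stay in place. The target has one more copy, with the label `none`. -/
def kappa (P : H →ₗ[ℂ] H) (k : ι) (a b : Option ι) :
    Grassmann ι H →ₐ[ℂ] Grassmann (Option ι) H :=
  ExteriorAlgebra.map
    (LinearMap.single ℂ (fun _ : Option ι => H) a ∘ₗ (LinearMap.id - P) ∘ₗ LinearMap.proj k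
      + LinearMap.single ℂ (fun _ : Option ι => H) b ∘ₗ P ∘ₗ LinearMap.proj k
      + ∑ q ∈ Finset.univ.erase k,
          LinearMap.single ℂ (fun _ : Option ι => H) (some q) ∘ₗ LinearMap.proj q)

/-- Identification of the elements that do not involve the auxiliary copy `none` with elements of
the original Grassmann algebra. -/
def forget : Grassmann (Option ι) H →ₐ[ℂ] Grassmann ι H :=
  ExteriorAlgebra.map (LinearMap.funLeft ℂ H (some : ι → Option ι))

/-- The circle product `∘_P^(k)` on the copy `k`; the other copies are spectators, and the Berezin
integral runs over the auxiliary copy `none`. -/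
def circ (A : H →ₗ⋆[ℂ] H) {P : H →ₗ[ℂ] H} {n : ℕ}
    (χ : OrthonormalBasis (Fin n) ℂ (LinearMap.range P)) (k : ι) (ξ ζ : Grassmann ι H) :
    Grassmann ι H :=
  (-1 : ℂ) ^ (Module.finrank ℂ H / 2) •
    forget (berezinIntegral A χ none
      (kappa P k (some k) none ξ * kappa P k none (some k) ζ
        * wedgeExp (-bilin A χ (some k) (some k)) * wedgeExp (bilin A χ (some k) none)
        * wedgeExp (-bilin A χ none none) * wedgeExp (bilin A χ none (some k))))

/-- The exponential for the circle product `∘_P^(k)`. -/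
def circExp (A : H →ₗ⋆[ℂ] H) {P : H →ₗ[ℂ] H} {n : ℕ}
    (χ : OrthonormalBasis (Fin n) ℂ (LinearMap.range P)) (k : ι) (x : Grassmann ι H) :
    Grassmann ι H :=
  expSeries (circ A χ k) x

end Circle

section Involution

/-- The opposite of an algebra, with the conjugate complex structure. Algebra homomorphisms
`E → ConjOp E` are the antilinear antimultiplicative unital maps `E → E`. -/
def ConjOp (E : Type*) : Type _ := Eᵐᵒᵖ

instance (E : Type*) [Ring E] : Ring (ConjOp E) := inferInstanceAs (Ring Eᵐᵒᵖ)

instance (E : Type*) [Ring E] [Algebra ℂ E] : Algebra ℂ (ConjOp E) :=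
  RingHom.toAlgebra' ((algebraMap ℂ Eᵐᵒᵖ).comp (starRingEnd ℂ))
    (fun c x => Algebra.commutes (A := Eᵐᵒᵖ) (starRingEnd ℂ c) x)

variable {ι H : Type*} [NormedAddCommGroup H] [InnerProductSpace ℂ H]

/-- The map `v ↦ A v` (copy by copy), into the Grassmann algebra with the opposite product and the
conjugate complex structure. -/
def starGen (A : H →ₗ⋆[ℂ] H) : (ι → H) →ₗ[ℂ] ConjOp (Grassmann ι H) where
  toFun v := MulOpposite.op (ExteriorAlgebra.ι ℂ fun q => A (v q))
  map_add' v w := by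
    have h : (fun q => A ((v + w) q)) = (fun q => A (v q)) + fun q => A (w q) := by
      funext q; simp
    rw [h, map_add]; rfl
  map_smul' c v := by
    have h : (fun q => A ((c • v) q)) = (starRingEnd ℂ c) • fun q => A (v q) := by
      funext q; simp
    rw [h, map_smul, RingHom.id_apply, Algebra.smul_def]
    exact (Algebra.smul_def (A := (Grassmann ι H)ᵐᵒᵖ) (starRingEnd ℂ c)
      (MulOpposite.op (ExteriorAlgebra.ι ℂ fun q => A (v q))))

theorem starGen_sq (A : H →ₗ⋆[ℂ] H) (v : ι → H) : starGen A v * starGen A v = 0 :=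
  congrArg MulOpposite.op (ExteriorAlgebra.ι_sq_zero (R := ℂ) fun q => A (v q))

/-- The involution of the Grassmann algebra: the antilinear map with `1* = 1`,
`(ξ ∧ ζ)* = ζ* ∧ ξ*` and `(φ^(q))* = (Aφ)^(q)`. -/
def grassStar (A : H →ₗ⋆[ℂ] H) (ξ : Grassmann ι H) : Grassmann ι H :=
  MulOpposite.unop (α := Grassmann ι H)
    (ExteriorAlgebra.lift ℂ ⟨starGen A, starGen_sq A⟩ ξ)

end Involution

section Weyl

variable {ι H : Type*} [Fintype ι] [DecidableEq ι]
  [NormedAddCommGroup H] [InnerProductSpace ℂ H]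

/-- The vector `(ψ_1^(q), (Aψ_1)^(q), …, ψ_n^(q), (Aψ_n)^(q))`; the entry `(0, j)` is `ψ_j^(q)` and
the entry `(1, j)` is `(Aψ_j)^(q)`. -/
def modes (A : H →ₗ⋆[ℂ] H) {P : H →ₗ[ℂ] H} {n : ℕ}
    (ψ : OrthonormalBasis (Fin n) ℂ (LinearMap.range P)) (q : ι) :
    Fin 2 × Fin n → Grassmann ι H :=
  fun p => ![copy q (ψ p.2 : H), copy q (A (ψ p.2 : H))] p.1

/-- The block diagonal matrix with `n` blocks `(0 1; 1 0)`. -/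
def swapMatrix (ι H : Type*) [NormedAddCommGroup H] [InnerProductSpace ℂ H] (n : ℕ) :
    Matrix (Fin 2 × Fin n) (Fin 2 × Fin n) (Grassmann ι H) :=
  Matrix.blockDiagonal fun _ : Fin n => !![0, 1; 1, 0]

/-- The pairing `(x, 𝒥 y) = xᵀ 𝒥 y`, the entries being multiplied with the exterior product. -/
def pairing {n : ℕ} (x y : Fin 2 × Fin n → Grassmann ι H) : Grassmann ι H :=
  x ⬝ᵥ (swapMatrix ι H n).mulVec y

/-- The Weyl displacement operator `𝕋_k(x) = exp (-(x, 𝒥 ψ^(k)))`, with the exponential of the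
algebra with product `∘_P^(k)`. The basis `χ` enters only in the circle product. -/
def weyl (A : H →ₗ⋆[ℂ] H) {P : H →ₗ[ℂ] H} {n : ℕ}
    (χ ψ : OrthonormalBasis (Fin n) ℂ (LinearMap.range P)) (k : ι)
    (x : Fin 2 × Fin n → Grassmann ι H) : Grassmann ι H :=
  circExp A χ k (-pairing x (modes A ψ k))

end Weyl

end GrassmannWeyl

end

theorem pow_mul_of_commutator {A : Type*} [Ring A] {x y c : A} (hxy : x * y = y * x + c)
    (hx : Commute x c) (r : ℕ) : x ^ (r + 1) * y = y * x ^ (r + 1) + (r + 1) • (c * x ^ r) := by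
  induction r with
  | zero => simp [hxy]
  | succ r ih =>
    rw [pow_succ' x (r + 1), mul_assoc, ih, mul_add, ← mul_assoc, hxy, mul_smul_comm, ← mul_assoc,
      hx.eq, mul_assoc c, ← pow_succ', succ_nsmul _ (r + 1), add_mul, mul_assoc]
    abel

namespace GrassmannWeyl

section NilExp

variable {A : Type*} [Ring A] [Algebra ℂ A]

/-- The exponential of a nilpotent element of a complex algebra. -/
noncomputable def nilExp (x : A) : A :=
  ∑ r ∈ Finset.range (nilpotencyClass x), ((r.factorial : ℂ)⁻¹) • x ^ r

theorem nilExp_eq_sum {x : A} {N : ℕ} (h : x ^ N = 0) :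
    nilExp x = ∑ r ∈ Finset.range N, ((r.factorial : ℂ)⁻¹) • x ^ r := by
  refine Finset.sum_subset (Finset.range_mono (csInf_le' h)) fun r _ hr => ?_
  rw [pow_eq_zero_of_le (by simpa using hr) (pow_nilpotencyClass ⟨N, h⟩), smul_zero]

open Polynomial

/-- The truncated exponential series `∑ tᵐʳ xʳ / r!` as a polynomial in `t`. -/
noncomputable def expPoly (m : ℕ) (x : A) (N : ℕ) : A[X] :=
  ∑ r ∈ Finset.range N, monomial (m * r) (((r.factorial : ℂ)⁻¹) • x ^ r)

theorem derivative_expPoly (m : ℕ) {x : A} {N : ℕ} (h : x ^ N = 0) :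
    derivative (expPoly (m + 1) x N) = monomial m ((m + 1) • x) * expPoly (m + 1) x N := by
  cases N with
  | zero => simp [expPoly]
  | succ N =>
    rw [expPoly, map_sum, Finset.sum_range_succ', Finset.mul_sum, Finset.sum_range_succ]
    simp only [monomial_mul_monomial, derivative_monomial]
    have hl : (m + 1) • x * (((N.factorial : ℂ)⁻¹) • x ^ N) = 0 := by
      rw [smul_mul_assoc, mul_smul_comm, ← pow_succ', h, smul_zero, smul_zero]
    rw [hl]
    simp only [mul_zero, Nat.cast_zero, monomial_zero_right, add_zero]
    refine Finset.sum_congr rfl fun r _ => ?_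
    have e : (m + 1) * (r + 1) - 1 = m + (m + 1) * r := by
      rw [Nat.sub_eq_iff_eq_add (Nat.succ_le_of_lt (by positivity))]; ring
    rw [e, smul_mul_assoc, ← nsmul_eq_mul', smul_mul_assoc, mul_smul_comm, ← pow_succ', ← Nat.cast_smul_eq_nsmul ℂ,
      ← Nat.cast_smul_eq_nsmul ℂ, smul_smul, smul_smul, Nat.factorial_succ]
    have h1 : ((r : ℂ) + 1) ≠ 0 := Nat.cast_add_one_ne_zero r
    have h2 : ((r.factorial : ℂ)) ≠ 0 := by exact_mod_cast r.factorial_ne_zero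
    congr 2
    push_cast
    field_simp

theorem expPoly_mul_C {x y c : A} {N : ℕ} (h : x ^ N = 0) (hxy : x * y = y * x + c)
    (hx : Commute x c) :
    expPoly 1 x N * C y = C y * expPoly 1 x N + monomial 1 c * expPoly 1 x N := by
  cases N with
  | zero => simp [expPoly]
  | succ N =>
    have e : monomial 1 c * expPoly 1 x (N + 1) = ∑ r ∈ Finset.range N,
        monomial (r + 1) (((r.factorial : ℂ)⁻¹) • (c * x ^ r)) + 
          monomial (N + 1) (((N.factorial : ℂ)⁻¹) • (c * x ^ N)) := by
      rw [expPoly, Finset.mul_sum, Finset.sum_range_succ]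
      simp [monomial_mul_monomial, add_comm]
    have e0 : c * x ^ N = 0 := by
      have h1 := pow_mul_of_commutator hxy hx N
      rw [h, zero_mul, mul_zero, zero_add, ← Nat.cast_smul_eq_nsmul ℂ] at h1
      exact (smul_eq_zero.1 h1.symm).resolve_left (Nat.cast_ne_zero.2 (Nat.succ_ne_zero N))
    rw [e, e0, smul_zero, monomial_zero_right, add_zero, expPoly, Finset.sum_mul, Finset.mul_sum,
      Finset.sum_range_succ', Finset.sum_range_succ' _ N, add_right_comm, ← Finset.sum_add_distrib]
    congr 1
    · refine Finset.sum_congr rfl fun r _ => ?_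
      rw [monomial_mul_C, C_mul_monomial, one_mul, ← map_add, smul_mul_assoc,
        pow_mul_of_commutator hxy hx, smul_add, mul_smul_comm, ← Nat.cast_smul_eq_nsmul ℂ,
        smul_smul, Nat.factorial_succ]
      have h1 : ((r : ℂ) + 1) ≠ 0 := Nat.cast_add_one_ne_zero r
      have h2 : ((r.factorial : ℂ)) ≠ 0 := by exact_mod_cast r.factorial_ne_zero
      congr 3
      push_cast
      field_simp
    · simp

/-- Evaluation at `t = 1`. -/
noncomputable def evalOne : A[X] →+* A :=
  eval₂RingHom' (RingHom.id A) 1 fun a => Commute.one_right a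

theorem evalOne_expPoly (m : ℕ) {x : A} {N : ℕ} (h : x ^ N = 0) :
    evalOne (expPoly m x N) = nilExp x := by
  rw [nilExp_eq_sum h, expPoly, map_sum]
  refine Finset.sum_congr rfl fun r _ => ?_
  simp [evalOne]

theorem nilExp_mul_of_commutator {x y c : A} (h : IsNilpotent x) (hxy : x * y = y * x + c)
    (hx : Commute x c) : nilExp x * y = (y + c) * nilExp x := by
  obtain ⟨N, h⟩ := h
  have := congrArg evalOne (expPoly_mul_C h hxy hx)
  rw [map_mul, map_add, map_mul, map_mul, evalOne_expPoly 1 h] at this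
  simpa [evalOne, eval₂_monomial, add_mul] using this

theorem nilExp_add_of_commutator {x y c : A} (hx : IsNilpotent x) (hy : IsNilpotent y)
    (hc : IsNilpotent c) (hxy : x * y = y * x + c) (hxc : Commute x c) (hyc : Commute y c) :
    IsNilpotent (x + y) ∧
      nilExp (x + y) = nilExp x * nilExp y * nilExp (-(1 / 2 : ℂ) • c) := by
  obtain ⟨a, ha⟩ := hx
  obtain ⟨b, hb⟩ := hy
  obtain ⟨k, hk⟩ := hc
  set z : A := -(1 / 2 : ℂ) • c with hz
  have hzk : z ^ k = 0 := by rw [hz, _root_.smul_pow, hk, smul_zero]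
  set F : A[X] := expPoly 1 x a * expPoly 1 y b * expPoly 2 z k with hF
  have hcp : Commute (monomial 1 c : A[X]) (expPoly 1 x a * expPoly 1 y b) := by
    have key : ∀ {u : A} (M : ℕ), Commute u c → Commute (monomial 1 c : A[X]) (expPoly 1 u M) :=
      fun {u} M hu => Commute.sum_right _ _ _ fun r _ => by
        rw [Commute, SemiconjBy, monomial_mul_monomial, monomial_mul_monomial, add_comm,
          (((hu.pow_left r).smul_left _).symm).eq]
    exact (key a hxc).mul_right (key b hyc)
  have hdz : derivative (expPoly 2 z k) = -(monomial 1 c) * expPoly 2 z k := by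
    rw [derivative_expPoly 1 hzk]
    congr 1
    rw [← map_neg, hz, ← Nat.cast_smul_eq_nsmul ℂ, smul_smul]
    norm_num
  have hdF : derivative F = C (x + y) * F := by
    rw [hF, derivative_mul, derivative_mul, hdz, derivative_expPoly 0 ha, derivative_expPoly 0 hb,
      zero_add, one_nsmul, one_nsmul, monomial_zero_left, monomial_zero_left,
      ← mul_assoc (expPoly 1 x a) (C y), expPoly_mul_C ha hxy hxc, ← mul_assoc _ (-_), mul_neg,
      ← hcp.eq, C_add]
    noncomm_ring
  have hcoef : ∀ r, F.coeff r = ((r.factorial : ℂ)⁻¹) • (x + y) ^ r := by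
    intro r
    induction r with
    | zero =>
      have h0 : ∀ (m : ℕ) (u : A) (M : ℕ), u ^ M = 0 → (expPoly (m + 1) u M).coeff 0 = 1 := by
        intro m u M hu
        cases M with
        | zero => rw [expPoly]; simpa using hu.symm
        | succ M =>
          rw [expPoly, finsetSum_coeff, Finset.sum_range_succ']
          simp [coeff_monomial]
      rw [hF, mul_coeff_zero, mul_coeff_zero, h0 0 x a ha, h0 0 y b hb, h0 1 z k hzk]
      simp
    | succ r ih =>
      have h1 := congrArg (fun p => coeff p r) hdF
      simp only [coeff_derivative, coeff_C_mul, ih, mul_smul_comm, ← pow_succ'] at h1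
      have h2 : ((r : ℂ) + 1) ≠ 0 := Nat.cast_add_one_ne_zero r
      have h3 : F.coeff (r + 1) = ((r : ℂ) + 1)⁻¹ • (F.coeff (r + 1) * ((r : A) + 1)) := by
        have h4 : ((r : A) + 1) = ((r + 1 : ℕ) : A) := by push_cast; rfl
        rw [h4, ← nsmul_eq_mul', ← Nat.cast_smul_eq_nsmul ℂ, smul_smul, Nat.cast_succ,
          inv_mul_cancel₀ h2, one_smul]
      rw [h3, h1, smul_smul, Nat.factorial_succ]
      congr 1
      push_cast
      rw [mul_inv]
  have hnil : (x + y) ^ (F.natDegree + 1) = 0 := by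
    have h1 := hcoef (F.natDegree + 1)
    rw [coeff_eq_zero_of_natDegree_lt (Nat.lt_succ_self _)] at h1
    exact (smul_eq_zero.1 h1.symm).resolve_left
      (inv_ne_zero (by exact_mod_cast Nat.factorial_ne_zero _))
  refine ⟨⟨_, hnil⟩, ?_⟩
  rw [← evalOne_expPoly 1 ha, ← evalOne_expPoly 1 hb, ← evalOne_expPoly 2 hzk, ← map_mul,
    ← map_mul, ← hF, nilExp_eq_sum hnil]
  conv_rhs => rw [F.as_sum_range, map_sum]
  refine Finset.sum_congr rfl fun r _ => ?_
  rw [hcoef]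
  simp [evalOne]

theorem nilExp_add_of_commute {x y : A} (hx : IsNilpotent x) (hy : IsNilpotent y)
    (hxy : Commute x y) : nilExp (x + y) = nilExp x * nilExp y := by
  rw [(nilExp_add_of_commutator (c := 0) hx hy IsNilpotent.zero (by rw [hxy.eq, add_zero])
    (Commute.zero_right x) (Commute.zero_right y)).2]
  rw [smul_zero, nilExp_eq_sum (pow_one (0 : A))]
  simp

theorem nilExp_zero : nilExp (0 : A) = 1 := by
  rw [nilExp_eq_sum (pow_one (0 : A))]
  simp

theorem nilExp_of_sq_zero {x : A} (hx : x * x = 0) : nilExp x = 1 + x := by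
  rw [nilExp_eq_sum (N := 2) (by rw [sq, hx])]
  simp [Finset.sum_range_succ]

theorem nilExp_neg_mul_self {x : A} (hx : IsNilpotent x) : nilExp (-x) * nilExp x = 1 := by
  rw [← nilExp_add_of_commute hx.neg hx (Commute.refl x).neg_left, neg_add_cancel, nilExp_zero]

/-- Conjugation by the exponential of a nilpotent element whose commutator with `y` is central. -/
theorem nilExp_conj {x y c : A} (h : IsNilpotent x) (hxy : x * y = y * x - c)
    (hx : Commute x c) : nilExp (-x) * y * nilExp x = y + c := by
  rw [nilExp_mul_of_commutator (c := c) h.neg (by rw [neg_mul, mul_neg, hxy]; abel) hx.neg_left,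
    mul_assoc, nilExp_neg_mul_self h, mul_one]

theorem nilExp_list_sum {κ : Type*} (f : κ → A) (l : List κ) (hsq : ∀ i, f i * f i = 0)
    (hcomm : ∀ i j, Commute (f i) (f j)) :
    IsNilpotent (l.map f).sum ∧ nilExp (l.map f).sum = (l.map fun i => 1 + f i).prod := by
  induction l with
  | nil => exact ⟨IsNilpotent.zero, nilExp_zero⟩
  | cons i l ih =>
    have hn : IsNilpotent (f i) := ⟨2, by rw [sq, hsq]⟩
    have hc : Commute (f i) (l.map f).sum := by
      refine Commute.list_sum_right _ _ fun x hx => ?_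
      obtain ⟨j, -, rfl⟩ := List.mem_map.1 hx
      exact hcomm i j
    rw [List.map_cons, List.sum_cons, List.map_cons, List.prod_cons,
      nilExp_add_of_commute hn ih.1 hc, ih.2, nilExp_of_sq_zero (hsq i)]
    exact ⟨hc.isNilpotent_add hn ih.1, rfl⟩

end NilExp

end GrassmannWeyl

namespace CliffordAlgebra

variable {R M : Type*} [CommRing R] [AddCommGroup M] [Module R M] {Q : QuadraticForm R M}

theorem involute_contractLeft (d : Module.Dual R M) (x : CliffordAlgebra Q) :
    involute (contractLeft d x) = -contractLeft d (involute x) := by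
  induction x using CliffordAlgebra.left_induction with
  | algebraMap r => simp
  | add x y hx hy => simp only [map_add, hx, hy]; abel
  | ι_mul x m hx =>
    simp only [contractLeft_ι_mul, map_sub, map_mul, involute_ι, map_smul, hx, neg_mul, map_neg]
    noncomm_ring

theorem contractLeft_mul (d : Module.Dual R M) (x y : CliffordAlgebra Q) :
    contractLeft d (x * y) = contractLeft d x * y + involute x * contractLeft d y := by
  induction x using CliffordAlgebra.left_induction with
  | algebraMap r => simp [contractLeft_algebraMap_mul]
  | add x x' hx hx' => simp only [add_mul, map_add, hx, hx']; abel
  | ι_mul x m hx =>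
    simp only [mul_assoc, contractLeft_ι_mul, hx, map_mul, involute_ι]
    simp only [sub_mul, mul_add, neg_mul, smul_mul_assoc, mul_assoc]
    abel

end CliffordAlgebra

namespace ExteriorAlgebra

open CliffordAlgebra (contractLeft involute contractLeft_mul contractLeft_ι_mul)

variable {R M N : Type*} [CommRing R] [AddCommGroup M] [Module R M] [AddCommGroup N] [Module R N]

theorem ι_mul_eq_involute_mul (v : M) (x : ExteriorAlgebra R M) :
    ι R v * x = involute x * ι R v := by
  induction x using CliffordAlgebra.left_induction with
  | algebraMap r => simpa using (Algebra.commutes r (ι R v)).symm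
  | add x x' hx hx' => simp only [add_mul, mul_add, map_add, hx, hx']
  | ι_mul x m hx =>
    have h : ι R v * ι R m = -(ι R m * ι R v) := eq_neg_of_add_eq_zero_left (ι_add_mul_swap v m)
    rw [map_mul, CliffordAlgebra.involute_ι, mul_assoc, ← hx, ← mul_assoc, h]
    simp only [neg_mul, mul_assoc]

theorem commute_bivector (v w : M) (x : ExteriorAlgebra R M) : Commute (ι R v * ι R w) x := by
  rw [Commute, SemiconjBy, mul_assoc, ι_mul_eq_involute_mul w, ← mul_assoc,
    ι_mul_eq_involute_mul v, CliffordAlgebra.involute_involute, mul_assoc]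

theorem bivector_mul_self (v w : M) : ι R v * ι R w * (ι R v * ι R w) = 0 := by
  rw [← mul_assoc, (commute_bivector v w (ι R v)).eq, ← mul_assoc, ι_sq_zero, zero_mul, zero_mul]

theorem contractLeft_map (f : M →ₗ[R] N) (d : Module.Dual R N) (x : ExteriorAlgebra R M) :
    contractLeft d (map f x) = map f (contractLeft (d ∘ₗ f) x) := by
  induction x using CliffordAlgebra.left_induction with
  | algebraMap r => simp
  | add x x' hx hx' => simp only [map_add, hx, hx']
  | ι_mul x m hx =>
    rw [map_mul, map_apply_ι, contractLeft_ι_mul, contractLeft_ι_mul, hx]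
    simp

theorem involute_map (f : M →ₗ[R] N) (x : ExteriorAlgebra R M) :
    involute (map f x) = map f (involute x) := by
  induction x using CliffordAlgebra.left_induction with
  | algebraMap r => simp
  | add x x' hx hx' => simp only [map_add, hx, hx']
  | ι_mul x m hx =>
    rw [map_mul, map_mul, map_mul, hx, map_apply_ι, CliffordAlgebra.involute_ι,
      CliffordAlgebra.involute_ι, map_mul, map_neg, map_apply_ι]

theorem contractLeft_one_sub_bivector_mul (d : Module.Dual R M) (b a : M)
    (x : ExteriorAlgebra R M) :
    contractLeft d ((1 - ι R b * ι R a) * x) =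
      (d a • ι R b - d b • ι R a) * x + (1 - ι R b * ι R a) * contractLeft d x := by
  rw [sub_mul, one_mul, mul_assoc, map_sub, contractLeft_ι_mul, contractLeft_ι_mul]
  simp only [sub_mul, mul_sub, smul_mul_assoc, mul_smul_comm, one_mul, mul_assoc]
  abel

section Gaussian

variable {κ : Type*} (a b : κ → M) (f g : κ → Module.Dual R M)

/-- The Berezin integral `∏ (f_j ⌋) (g_j ⌋)`. -/
noncomputable def listIntegral (l : List κ) : Module.End R (ExteriorAlgebra R M) :=
  (l.map fun j => (contractLeft (f j) * contractLeft (g j) :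
    Module.End R (ExteriorAlgebra R M))).prod

/-- The Gaussian `∏ (1 - b_j ∧ a_j) = exp (-∑ b_j ∧ a_j)`. -/
noncomputable def listGaussian (l : List κ) : ExteriorAlgebra R M :=
  (l.map fun j => 1 - ι R (b j) * ι R (a j)).prod

variable {a b f g}

theorem listIntegral_cons (j : κ) (l : List κ) (x : ExteriorAlgebra R M) :
    listIntegral f g (j :: l) x = contractLeft (f j) (contractLeft (g j) (listIntegral f g l x)) :=
  rfl

theorem listGaussian_cons (j : κ) (l : List κ) : listGaussian (R := R) a b (j :: l) =
    (1 - ι R (b j) * ι R (a j)) * listGaussian a b l := by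
  simp [listGaussian]

theorem listIntegral_ι_mul {s : M} (hf : ∀ j, f j s = 0) (hg : ∀ j, g j s = 0) (l : List κ)
    (x : ExteriorAlgebra R M) : listIntegral f g l (ι R s * x) = ι R s * listIntegral f g l x := by
  induction l with
  | nil => rfl
  | cons j l ih =>
    rw [listIntegral_cons, ih, contractLeft_ι_mul, hg, zero_smul, zero_sub, map_neg,
      contractLeft_ι_mul, hf, zero_smul, zero_sub, neg_neg, listIntegral_cons]

theorem listIntegral_contractLeft_comm (d : Module.Dual R M) (l : List κ)
    (x : ExteriorAlgebra R M) :
    listIntegral f g l (contractLeft d x) = contractLeft d (listIntegral f g l x) := by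
  induction l with
  | nil => rfl
  | cons j l ih =>
    rw [listIntegral_cons, ih, CliffordAlgebra.contractLeft_comm _ d, map_neg,
      CliffordAlgebra.contractLeft_comm _ d, neg_neg, listIntegral_cons]

theorem listIntegral_contractLeft {i : κ} {l : List κ} (hi : i ∈ l) (x : ExteriorAlgebra R M) :
    listIntegral f g l (contractLeft (f i) x) = 0 ∧
      listIntegral f g l (contractLeft (g i) x) = 0 := by
  induction l with
  | nil => simp at hi
  | cons j l ih =>
    rw [listIntegral_cons, listIntegral_cons]
    rcases List.mem_cons.1 hi with rfl | hi
    · rw [listIntegral_contractLeft_comm, listIntegral_contractLeft_comm,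
        CliffordAlgebra.contractLeft_contractLeft, CliffordAlgebra.contractLeft_comm,
        CliffordAlgebra.contractLeft_contractLeft, map_zero, map_zero, neg_zero]
      exact ⟨rfl, rfl⟩
    · rw [(ih hi).1, (ih hi).2]
      simp

theorem contractLeft_listGaussian_of_notMem {d : Module.Dual R M} {l : List κ}
    (h : ∀ j ∈ l, d (a j) = 0 ∧ d (b j) = 0) : contractLeft d (listGaussian a b l) = 0 := by
  induction l with
  | nil => exact CliffordAlgebra.contractLeft_one (Q := 0) d
  | cons j l ih =>
    rw [List.forall_mem_cons] at h
    rw [listGaussian_cons, contractLeft_one_sub_bivector_mul, ih h.2, h.1.1, h.1.2]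
    simp

theorem contractLeft_listGaussian {d : Module.Dual R M} {i : κ} {l : List κ} (hl : l.Nodup)
    (hi : i ∈ l) (h : ∀ j, j ≠ i → d (a j) = 0 ∧ d (b j) = 0) :
    contractLeft d (listGaussian a b l) =
      (d (a i) • ι R (b i) - d (b i) • ι R (a i)) * listGaussian a b l := by
  induction l with
  | nil => simp at hi
  | cons j l ih =>
    rw [List.nodup_cons] at hl
    rw [listGaussian_cons, contractLeft_one_sub_bivector_mul]
    rcases List.mem_cons.1 hi with rfl | hi
    · rw [contractLeft_listGaussian_of_notMem fun j hj => h j fun hji => hl.1 (hji ▸ hj), mul_zero,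
        add_zero, ← mul_assoc]
      congr 1
      rw [mul_sub, ← (commute_bivector (b i) (a i) _).eq, mul_sub]
      simp [mul_assoc, (commute_bivector (b i) (a i) (ι R (b i))).eq]
      simp [← mul_assoc]
    · have hj : j ≠ i := fun e => hl.1 (e ▸ hi)
      have hc : Commute (1 - ι R (b j) * ι R (a j)) (d (a i) • ι R (b i) - d (b i) • ι R (a i)) :=
        (Commute.one_left _).sub_left (commute_bivector _ _ _)
      rw [(h j hj).1, (h j hj).2, ih hl.2 hi, ← mul_assoc, hc.eq, mul_assoc]
      simp

variable [DecidableEq κ] (hfa : ∀ i j, f i (a j) = if i = j then 1 else 0) (hfb : ∀ i j, f i (b j) = 0)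
  (hga : ∀ i j, g i (a j) = 0) (hgb : ∀ i j, g i (b j) = if i = j then 1 else 0)

include hfa hfb hga hgb

theorem listIntegral_listGaussian {l : List κ} (hl : l.Nodup) :
    listIntegral f g l (listGaussian a b l) = algebraMap R _ ((-1) ^ l.length) := by
  induction l with
  | nil => simp [listIntegral, listGaussian]
  | cons j l ih =>
    rw [List.nodup_cons] at hl
    have key : ∀ (l : List κ) (x : ExteriorAlgebra R M), j ∉ l →
        listIntegral f g l ((1 - ι R (b j) * ι R (a j)) * x) =
          (1 - ι R (b j) * ι R (a j)) * listIntegral f g l x := by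
      intro l x hj
      induction l with
      | nil => rfl
      | cons i l ih =>
        rw [List.mem_cons, not_or] at hj
        rw [listIntegral_cons, ih hj.2, contractLeft_one_sub_bivector_mul,
          hga, hgb, if_neg (Ne.symm hj.1), zero_smul, zero_smul, sub_zero, zero_mul, zero_add,
          contractLeft_one_sub_bivector_mul, hfa, hfb, if_neg (Ne.symm hj.1), zero_smul, zero_smul,
          sub_zero, zero_mul, zero_add, listIntegral_cons]
    rw [listIntegral_cons, listGaussian_cons, key l _ hl.1, ih hl.2,
      contractLeft_one_sub_bivector_mul, hga, hgb, if_pos rfl, CliffordAlgebra.contractLeft_algebraMap,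
      mul_zero, add_zero, zero_smul, one_smul, zero_sub, neg_mul, map_neg, contractLeft_ι_mul, hfa,
      if_pos rfl, CliffordAlgebra.contractLeft_algebraMap, mul_zero, one_smul, sub_zero,
      List.length_cons, pow_succ]
    simp

theorem listIntegral_ι_mul_gaussian {i : κ} {l : List κ} (hl : l.Nodup) (hi : i ∈ l)
    (x : ExteriorAlgebra R M) :
    listIntegral f g l (ι R (a i) * x * listGaussian a b l) =
        listIntegral f g l (contractLeft (g i) x * listGaussian a b l) ∧
      listIntegral f g l (ι R (b i) * x * listGaussian a b l) =
        -listIntegral f g l (contractLeft (f i) x * listGaussian a b l) := by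
  have h1 := (listIntegral_contractLeft (f := f) (g := g) hi (x * listGaussian a b l)).2
  have h2 := (listIntegral_contractLeft (f := f) (g := g) hi (x * listGaussian a b l)).1
  rw [contractLeft_mul, contractLeft_listGaussian hl hi fun j hj =>
    ⟨hga i j, by rw [hgb, if_neg hj.symm]⟩, hga, hgb, if_pos rfl, zero_smul, one_smul, zero_sub,
    neg_mul, mul_neg, ← mul_assoc, ← ι_mul_eq_involute_mul, map_add, map_neg] at h1
  rw [contractLeft_mul, contractLeft_listGaussian hl hi fun j hj =>
    ⟨by rw [hfa, if_neg hj.symm], hfb i j⟩, hfa, hfb, if_pos rfl, zero_smul, one_smul, sub_zero,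
    ← mul_assoc, ← ι_mul_eq_involute_mul, map_add] at h2
  exact ⟨(add_neg_eq_zero.1 h1).symm, eq_neg_of_add_eq_zero_right h2⟩

end Gaussian

end ExteriorAlgebra

noncomputable section

namespace GrassmannWeyl

open CliffordAlgebra (contractLeft involute contractLeft_mul contractLeft_ι_mul)
open ExteriorAlgebra (listIntegral listGaussian)

section BasisProjection

variable {H : Type*} [NormedAddCommGroup H] [InnerProductSpace ℂ H] {A : H →ₗ⋆[ℂ] H}
  {P : H →ₗ[ℂ] H}

theorem IsBasisProjection.apply_of_mem (hP : IsBasisProjection A P) {x : H}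
    (hx : x ∈ LinearMap.range P) : P x = x := by
  obtain ⟨y, rfl⟩ := hx
  exact LinearMap.congr_fun hP.isSymmetricProjection.isIdempotentElem y

theorem IsBasisProjection.apply_conj (hA : IsSelfDual A) (hP : IsBasisProjection A P) (x : H) :
    P (A x) = A x - A (P x) := by
  have h := hP.conj_eq (A x)
  rw [hA.involutive] at h
  rw [h]; abel

theorem IsBasisProjection.inner_left (hP : IsBasisProjection A P) (x y : H) :
    inner ℂ (P x) y = inner ℂ x (P y) :=
  hP.isSymmetricProjection.isSymmetric x y

theorem IsBasisProjection.apply_conj_of_mem (hA : IsSelfDual A) (hP : IsBasisProjection A P)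
    {x : H} (hx : x ∈ LinearMap.range P) : P (A x) = 0 := by
  rw [hP.apply_conj hA, hP.apply_of_mem hx, sub_self]

theorem IsBasisProjection.inner_conj_of_mem (hA : IsSelfDual A) (hP : IsBasisProjection A P)
    {x y : H} (hx : x ∈ LinearMap.range P) (hy : y ∈ LinearMap.range P) :
    inner ℂ x (A y) = 0 := by
  rw [← hP.apply_of_mem hx, hP.inner_left, hP.apply_conj_of_mem hA hy, inner_zero_right]

theorem IsBasisProjection.inner_conj_left_of_mem (hA : IsSelfDual A) (hP : IsBasisProjection A P)
    {x y : H} (hx : x ∈ LinearMap.range P) (hy : y ∈ LinearMap.range P) :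
    inner ℂ (A x) y = 0 := by
  rw [← inner_conj_symm, hP.inner_conj_of_mem hA hy hx, map_zero]

theorem IsBasisProjection.finrank_eq [FiniteDimensional ℂ H] (hA : IsSelfDual A)
    (hP : IsBasisProjection A P) {n : ℕ} (χ : OrthonormalBasis (Fin n) ℂ (LinearMap.range P)) :
    Module.finrank ℂ H / 2 = n := by
  have h1 : Module.finrank ℂ (LinearMap.range P) = n := by
    rw [Module.finrank_eq_card_basis χ.toBasis, Fintype.card_fin]
  have hker : ∀ x, x ∈ LinearMap.ker P → A x ∈ LinearMap.range P := fun x hx =>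
    ⟨A x, by rw [hP.apply_conj hA, LinearMap.mem_ker.1 hx, map_zero, sub_zero]⟩
  let j : LinearMap.range P ≃+ LinearMap.ker P :=
    { toFun := fun x => ⟨A x, hP.apply_conj_of_mem hA x.2⟩
      invFun := fun x => ⟨A x, hker x x.2⟩
      left_inv := fun x => Subtype.ext (hA.involutive x)
      right_inv := fun x => Subtype.ext (hA.involutive x)
      map_add' := fun x y => Subtype.ext (map_add A _ _) }
  have h2 : Module.finrank ℂ (LinearMap.range P) = Module.finrank ℂ (LinearMap.ker P) := by
    have := lift_rank_eq_of_equiv_equiv (starRingEnd ℂ) j (starRingAut (R := ℂ)).bijective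
      (fun r x => Subtype.ext (LinearMap.map_smulₛₗ A r (x : H)))
    simp only [Module.finrank]
    simpa using congrArg Cardinal.toNat this
  have h3 := P.finrank_range_add_finrank_ker
  omega

theorem mem_span_basis {n : ℕ} (χ : OrthonormalBasis (Fin n) ℂ (LinearMap.range P)) {x : H}
    (hx : x ∈ LinearMap.range P) : x ∈ Submodule.span ℂ (Set.range fun j => (χ j : H)) := by
  have h : (LinearMap.range P).subtype ⟨x, hx⟩ ∈
      Submodule.map (LinearMap.range P).subtype (Submodule.span ℂ (Set.range χ)) :=
    Submodule.mem_map_of_mem (by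
      have := χ.toBasis.span_eq
      rw [OrthonormalBasis.coe_toBasis] at this
      rw [this]; trivial)
  rw [Submodule.map_span, ← Set.range_comp] at h
  exact h

end BasisProjection

section Copy

variable {ι H : Type*} [DecidableEq ι] [NormedAddCommGroup H] [InnerProductSpace ℂ H]

theorem copy_add (q : ι) (x y : H) : copy q (x + y) = copy q x + copy q y := by
  simp [copy, Pi.single_add]

theorem copy_smul (q : ι) (r : ℂ) (x : H) : copy q (r • x) = r • copy q x := by
  simp [copy, Pi.single_smul]

theorem copy_zero (q : ι) : copy q (0 : H) = 0 := by
  simp [copy]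

omit [DecidableEq ι] in
/-- The functional `v ↦ ⟨φ, v_q⟩`. -/
def dualAt (q : ι) (φ : H) : Module.Dual ℂ (ι → H) :=
  innerₛₗ ℂ φ ∘ₗ (LinearMap.proj q : (ι → H) →ₗ[ℂ] H)

omit [DecidableEq ι] in
@[simp]
theorem dualAt_apply (q : ι) (φ : H) (v : ι → H) : dualAt q φ v = inner ℂ φ (v q) := rfl

omit [DecidableEq ι] in
theorem expSeries_eq_sum {mul : Grassmann ι H → Grassmann ι H → Grassmann ι H} {x : Grassmann ι H}
    {N : ℕ} (h : ∀ r, N ≤ r → (mul x)^[r] 1 = 0) :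
    expSeries mul x = ∑ r ∈ Finset.range N, ((r.factorial : ℂ)⁻¹) • (mul x)^[r] 1 := by
  let _ : TopologicalSpace (Grassmann ι H) := moduleTopology ℂ (Grassmann ι H)
  exact tsum_eq_sum fun r hr => by rw [h r (by simpa using hr), smul_zero]

omit [DecidableEq ι] in
theorem wedgeExp_eq_nilExp {x : Grassmann ι H} (hx : IsNilpotent x) : wedgeExp x = nilExp x := by
  obtain ⟨N, hN⟩ := hx
  have hp : ∀ r : ℕ, (fun ζ => x * ζ)^[r] 1 = x ^ r := fun r => by
    simp [mul_left_iterate]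
  rw [nilExp_eq_sum hN, wedgeExp, expSeries_eq_sum fun r hr => by
    rw [hp, pow_eq_zero_of_le hr hN]]
  simp only [hp]

end Copy

section Gaussian

variable {ι H : Type*} [DecidableEq ι] [NormedAddCommGroup H] [InnerProductSpace ℂ H]
  (A : H →ₗ⋆[ℂ] H) {P : H →ₗ[ℂ] H} {n : ℕ}
  (χ : OrthonormalBasis (Fin n) ℂ (LinearMap.range P))

/-- The vector `φ^(a) - φ^(k)`, where `a` is the auxiliary copy. -/
def diffVec (k : ι) (φ : H) : Option ι → H := Pi.single none φ - Pi.single (some k) φ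

theorem bilin_nilpotent (p q : ι) : IsNilpotent (bilin A χ p q) :=
  Commute.isNilpotent_sum
    (fun _ _ => ⟨2, by rw [sq]; exact ExteriorAlgebra.bivector_mul_self _ _⟩)
    fun _ _ _ _ => ExteriorAlgebra.commute_bivector _ _ _

theorem commute_bilin (p q : ι) (x : Grassmann ι H) : Commute (bilin A χ p q) x :=
  Commute.sum_left _ _ _ fun _ _ => ExteriorAlgebra.commute_bivector _ _ _

theorem wedgeExp_bilin_mul (k : ι) :
    wedgeExp (-bilin A χ (some k) (some k)) * wedgeExp (bilin A χ (some k) none)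
        * wedgeExp (-bilin A χ none none) * wedgeExp (bilin A χ none (some k)) =
      listGaussian (R := ℂ) (fun j => diffVec k (χ j : H)) (fun j => diffVec k (A (χ j : H)))
        (List.finRange n) := by
  have hn := bilin_nilpotent (ι := Option ι) A χ
  have hc := commute_bilin (ι := Option ι) A χ
  rw [wedgeExp_eq_nilExp (hn _ _).neg, wedgeExp_eq_nilExp (hn _ _),
    wedgeExp_eq_nilExp (hn _ _).neg, wedgeExp_eq_nilExp (hn _ _)]
  have n2 := (hc (some k) (some k) (bilin A χ (some k) none)).neg_left.isNilpotent_add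
    (hn _ _).neg (hn _ _)
  have n3 := (hc none none
    (-bilin A χ (some k) (some k) + bilin A χ (some k) none)).symm.neg_right.isNilpotent_add
    n2 (hn _ _).neg
  rw [← nilExp_add_of_commute (hn _ _).neg (hn _ _) (hc _ _ _).neg_left,
    ← nilExp_add_of_commute n2 (hn _ _).neg (hc _ _ _).symm.neg_right,
    ← nilExp_add_of_commute n3 (hn _ _) (hc _ _ _).symm]
  have key := nilExp_list_sum
    (fun j : Fin n => -(ExteriorAlgebra.ι ℂ (diffVec k (A (χ j : H))) *
      ExteriorAlgebra.ι ℂ (diffVec k (χ j : H)))) (List.finRange n)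
    (fun j => by rw [neg_mul_neg, ExteriorAlgebra.bivector_mul_self])
    (fun i j => (ExteriorAlgebra.commute_bivector _ _ _).neg_left)
  rw [listGaussian]
  simp only [sub_eq_add_neg]
  rw [← key.2]
  congr 1
  rw [← List.ofFn_eq_map, List.sum_ofFn]
  simp only [bilin, ← Finset.sum_neg_distrib, ← Finset.sum_add_distrib]
  refine Finset.sum_congr rfl fun j _ => ?_
  simp only [diffVec, copy, map_sub]
  noncomm_ring

/-- The functional `ω ↦ (-1)ⁿ ∫ ω ∧ G`, where `G` is the Gaussian in the circle product. -/
def gaussIntegral (k : ι) (ω : Grassmann (Option ι) H) : Grassmann ι H :=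
  (-1 : ℂ) ^ n • forget (berezinIntegral A χ none (ω *
    listGaussian (R := ℂ) (fun j => diffVec k (χ j : H)) (fun j => diffVec k (A (χ j : H)))
        (List.finRange n)))

omit [DecidableEq ι] in
theorem berezinIntegral_eq (q : ι) : berezinIntegral A χ q =
    listIntegral (fun j => dualAt q (χ j : H)) (fun j => dualAt q (A (χ j : H)))
      (List.finRange n) := by
  rw [berezinIntegral, listIntegral, List.ofFn_eq_map]
  rfl

theorem circ_eq_gaussIntegral [Fintype ι] [FiniteDimensional ℂ H] (hA : IsSelfDual A)
    (hP : IsBasisProjection A P) (k : ι) (ξ ζ : Grassmann ι H) :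
    circ A χ k ξ ζ =
      gaussIntegral A χ k (kappa P k (some k) none ξ * kappa P k none (some k) ζ) := by
  rw [circ, gaussIntegral, hP.finrank_eq hA χ, ← wedgeExp_bilin_mul]
  simp only [mul_assoc]

theorem gaussIntegral_add (k : ι) (ω η : Grassmann (Option ι) H) :
    gaussIntegral A χ k (ω + η) = gaussIntegral A χ k ω + gaussIntegral A χ k η := by
  simp only [gaussIntegral, add_mul, map_add, smul_add]

theorem gaussIntegral_smul (k : ι) (r : ℂ) (ω : Grassmann (Option ι) H) :
    gaussIntegral A χ k (r • ω) = r • gaussIntegral A χ k ω := by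
  simp only [gaussIntegral, smul_mul_assoc, map_smul, smul_comm r]

theorem gaussIntegral_zero (k : ι) : gaussIntegral A χ k (0 : Grassmann (Option ι) H) = 0 := by
  simp [gaussIntegral]

theorem gaussIntegral_ι_mul (k : ι) {s : Option ι → H} (hs : s none = 0)
    (ω : Grassmann (Option ι) H) :
    gaussIntegral A χ k (ExteriorAlgebra.ι ℂ s * ω) =
      ExteriorAlgebra.ι ℂ (fun q => s (some q)) * gaussIntegral A χ k ω := by
  rw [gaussIntegral, gaussIntegral, berezinIntegral_eq, mul_assoc,
    ExteriorAlgebra.listIntegral_ι_mul (by simp [hs]) (by simp [hs]), map_mul, mul_smul_comm]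
  congr 2
  rw [forget, ExteriorAlgebra.map_apply_ι]
  rfl

variable {A}

theorem inner_basis (i j : Fin n) : inner ℂ (χ i : H) (χ j : H) = if i = j then 1 else 0 := by
  have := orthonormal_iff_ite.1 χ.orthonormal i j
  simpa using this

section

variable (hA : IsSelfDual A) (hP : IsBasisProjection A P)
include hA hP

theorem dualAt_diffVec (k : ι) (i j : Fin n) :
    dualAt none (χ i : H) (diffVec k (χ j : H)) = (if i = j then 1 else 0) ∧
    dualAt none (χ i : H) (diffVec k (A (χ j : H))) = 0 ∧
    dualAt none (A (χ i : H)) (diffVec k (χ j : H)) = 0 ∧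
    dualAt none (A (χ i : H)) (diffVec k (A (χ j : H))) = (if i = j then 1 else 0) := by
  have h : ∀ x : H, (diffVec k x : Option ι → H) none = x := fun x => by simp [diffVec]
  simp only [dualAt_apply, h, hA.inner_map, inner_basis χ,
    hP.inner_conj_of_mem hA (χ i).2 (χ j).2, hP.inner_conj_left_of_mem hA (χ i).2 (χ j).2]
  simp [eq_comm]

theorem gaussIntegral_one (k : ι) : gaussIntegral A χ k (1 : Grassmann (Option ι) H) = 1 := by
  have h := fun i j => dualAt_diffVec χ hA hP k i j
  rw [gaussIntegral, berezinIntegral_eq, one_mul, ExteriorAlgebra.listIntegral_listGaussian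
    (fun i j => (h i j).1) (fun i j => (h i j).2.1) (fun i j => (h i j).2.2.1)
    (fun i j => (h i j).2.2.2) (List.nodup_finRange n), List.length_finRange, AlgHom.commutes,
    Algebra.smul_def, ← map_mul, ← mul_pow]
  simp

theorem gaussIntegral_diffVec_mul (k : ι) (j : Fin n) (ω : Grassmann (Option ι) H) :
    gaussIntegral A χ k (ExteriorAlgebra.ι ℂ (diffVec k (χ j : H)) * ω) =
        gaussIntegral A χ k (contractLeft (dualAt none (A (χ j : H))) ω) ∧
      gaussIntegral A χ k (ExteriorAlgebra.ι ℂ (diffVec k (A (χ j : H))) * ω) =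
        -gaussIntegral A χ k (contractLeft (dualAt none (χ j : H)) ω) := by
  have h := fun i j => dualAt_diffVec χ hA hP k i j
  have h' := ExteriorAlgebra.listIntegral_ι_mul_gaussian
    (fun i j => (h i j).1) (fun i j => (h i j).2.1) (fun i j => (h i j).2.2.1)
    (fun i j => (h i j).2.2.2) (List.nodup_finRange n) (List.mem_finRange j) ω
  simp only [gaussIntegral, berezinIntegral_eq]
  rw [h'.1, h'.2, map_neg, smul_neg]
  exact ⟨rfl, rfl⟩

end

end Gaussian

end GrassmannWeyl

end

noncomputable section

namespace GrassmannWeyl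

open CliffordAlgebra (contractLeft involute contractLeft_mul contractLeft_ι_mul)
open ExteriorAlgebra (listIntegral listGaussian)

section Shift

variable {ι H : Type*} [DecidableEq ι] [NormedAddCommGroup H] [InnerProductSpace ℂ H]
  {A : H →ₗ⋆[ℂ] H} {P : H →ₗ[ℂ] H} {n : ℕ}
  (χ : OrthonormalBasis (Fin n) ℂ (LinearMap.range P))
  (hA : IsSelfDual A) (hP : IsBasisProjection A P)

theorem gaussIntegral_copy_some_mul (k : ι) (φ : H) (ω : Grassmann (Option ι) H) :
    gaussIntegral A χ k (copy (some k) φ * ω) = copy k φ * gaussIntegral A χ k ω := by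
  rw [copy, gaussIntegral_ι_mul A χ k (by simp)]
  congr 2
  funext q
  rcases eq_or_ne q k with rfl | h
  · simp
  · rw [Pi.single_eq_of_ne h, Pi.single_eq_of_ne (by simpa using h)]

theorem copy_none_eq (k : ι) (φ : H) : (copy none φ : Grassmann (Option ι) H) =
    copy (some k) φ + ExteriorAlgebra.ι ℂ (diffVec k φ) := by
  simp [copy, diffVec]

include hA hP

theorem gaussIntegral_copy_none_mul (k : ι) {φ : H} (hφ : φ ∈ LinearMap.range P)
    (ω : Grassmann (Option ι) H) :
    gaussIntegral A χ k (copy none φ * ω) =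
      copy k φ * gaussIntegral A χ k ω +
        gaussIntegral A χ k (contractLeft (dualAt none (A φ)) ω) := by
  have hd : ∀ x y : H, dualAt (none : Option ι) (A (x + y)) =
      dualAt none (A x) + dualAt none (A y) := fun x y => by
    ext; simp
  have hs : ∀ (r : ℂ) (x : H), dualAt (none : Option ι) (A (r • x)) =
      r • dualAt none (A x) := fun r x => by
    ext; simp [mul_comm]
  have h0 : dualAt (none : Option ι) (0 : H) = 0 := by ext; simp
  replace hφ := mem_span_basis χ hφ
  induction hφ using Submodule.span_induction with
  | mem x hx =>
    obtain ⟨j, rfl⟩ := hx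
    rw [copy_none_eq k, add_mul, gaussIntegral_add, gaussIntegral_copy_some_mul,
      (gaussIntegral_diffVec_mul χ hA hP k j ω).1]
  | zero => simp [copy_zero, gaussIntegral_zero, h0]
  | add x y _ _ hx hy =>
    rw [copy_add, copy_add, add_mul, gaussIntegral_add, hx, hy, hd, map_add, LinearMap.add_apply,
      gaussIntegral_add, add_mul]
    abel
  | smul r x _ hx =>
    rw [copy_smul, copy_smul, smul_mul_assoc, gaussIntegral_smul, hx, hs, map_smul,
      LinearMap.smul_apply, gaussIntegral_smul, smul_mul_assoc, smul_add]

theorem gaussIntegral_copy_none_conj_mul (k : ι) {φ : H} (hφ : φ ∈ LinearMap.range P)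
    {ω : Grassmann (Option ι) H}
    (hω : ∀ x ∈ LinearMap.range P, contractLeft (dualAt none x) ω = 0) :
    gaussIntegral A χ k (copy none (A φ) * ω) = copy k (A φ) * gaussIntegral A χ k ω := by
  replace hφ := mem_span_basis χ hφ
  induction hφ using Submodule.span_induction with
  | mem x hx =>
    obtain ⟨j, rfl⟩ := hx
    rw [copy_none_eq k, add_mul, gaussIntegral_add, gaussIntegral_copy_some_mul,
      (gaussIntegral_diffVec_mul χ hA hP k j ω).2, hω _ (χ j).2, gaussIntegral_zero, neg_zero,
      add_zero]
  | zero => simp [copy_zero, gaussIntegral_zero]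
  | add x y _ _ hx hy =>
    rw [map_add, copy_add, copy_add, add_mul, gaussIntegral_add, hx, hy, add_mul]
  | smul r x _ hx =>
    rw [LinearMap.map_smulₛₗ, copy_smul, copy_smul, smul_mul_assoc, gaussIntegral_smul, hx,
      smul_mul_assoc]

end Shift

section Circle

variable {ι H : Type*} [Fintype ι] [DecidableEq ι] [NormedAddCommGroup H] [InnerProductSpace ℂ H]
  {A : H →ₗ⋆[ℂ] H} {P : H →ₗ[ℂ] H}

variable (P) in
/-- The linear map underlying `kappa`. -/
def kappaLin (k : ι) (a b : Option ι) : (ι → H) →ₗ[ℂ] (Option ι → H) :=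
  LinearMap.single ℂ (fun _ : Option ι => H) a ∘ₗ (LinearMap.id - P) ∘ₗ LinearMap.proj k
    + LinearMap.single ℂ (fun _ : Option ι => H) b ∘ₗ P ∘ₗ LinearMap.proj k
    + ∑ q ∈ Finset.univ.erase k,
        LinearMap.single ℂ (fun _ : Option ι => H) (some q) ∘ₗ LinearMap.proj q

theorem kappa_eq_map (k : ι) (a b : Option ι) :
    kappa P k a b = ExteriorAlgebra.map (kappaLin P k a b) := rfl

theorem kappaLin_apply (k : ι) (a b : Option ι) (v : ι → H) :
    kappaLin P k a b v = Pi.single a (v k - P (v k)) + Pi.single b (P (v k)) +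
      fun o => o.elim 0 (fun q => if q = k then 0 else v q) := by
  simp only [kappaLin, LinearMap.add_apply, LinearMap.comp_apply, LinearMap.sum_apply,
    LinearMap.proj_apply, LinearMap.single_apply, LinearMap.sub_apply, LinearMap.id_apply]
  congr 1
  funext o
  rw [Finset.sum_apply]
  cases o with
  | none => simp
  | some q => simp [Pi.single_apply, Finset.sum_ite_eq]

variable (A P) in
/-- The bilinear form `(v, w) ↦ ⟨A P v_k, w_k⟩`. -/
def contraction (k : ι) : LinearMap.BilinForm ℂ (ι → H) :=
  LinearMap.mk₂ ℂ (fun v w => inner ℂ (A (P (v k))) (w k))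
    (by simp) (by simp [mul_comm]) (by simp) (by simp)

omit [Fintype ι] [DecidableEq ι] in
@[simp]
theorem contraction_apply (k : ι) (v w : ι → H) :
    contraction A P k v w = inner ℂ (A (P (v k))) (w k) := rfl

omit [Fintype ι] [DecidableEq ι] in
theorem contraction_eq_dualAt (k : ι) (v : ι → H) :
    contraction A P k v = dualAt k (A (P (v k))) := rfl

variable (hA : IsSelfDual A) (hP : IsBasisProjection A P)
include hA hP

theorem dualAt_comp_kappaLin (k : ι) {x : H} (hx : x ∈ LinearMap.range P) :
    dualAt none (A x) ∘ₗ kappaLin P k (some k) none = 0 ∧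
    dualAt none (A x) ∘ₗ kappaLin P k none (some k) = dualAt k (A x) ∧
    dualAt none x ∘ₗ kappaLin P k none (some k) = 0 := by
  have h1 : ∀ y, inner ℂ (A x) (P y) = 0 := fun y => by
    rw [← hP.inner_left, hP.apply_conj_of_mem hA hx, inner_zero_left]
  have h2 : ∀ y, inner ℂ x (P y) = inner ℂ x y := fun y => by
    rw [← hP.inner_left, hP.apply_of_mem hx]
  refine ⟨LinearMap.ext fun v => ?_, LinearMap.ext fun v => ?_, LinearMap.ext fun v => ?_⟩ <;>
  simp [kappaLin_apply, h1, h2]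

omit hA hP in
theorem ι_kappaLin_left (k : ι) (v : ι → H) :
    ExteriorAlgebra.ι ℂ (kappaLin P k (some k) none v) =
      copy none (P (v k)) + ExteriorAlgebra.ι ℂ (fun o : Option ι => o.elim 0 fun q =>
        if q = k then v k - P (v k) else v q) := by
  rw [copy, ← map_add, kappaLin_apply, add_comm (Pi.single (some k) _), add_assoc]
  congr 2
  funext o
  cases o with
  | none => simp
  | some q =>
    rcases eq_or_ne q k with rfl | h <;> simp [*]

omit hA hP in
theorem ι_kappaLin_right (k : ι) (v : ι → H) :
    ExteriorAlgebra.ι ℂ (kappaLin P k none (some k) v) =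
      copy none (v k - P (v k)) + ExteriorAlgebra.ι ℂ (fun o : Option ι => o.elim 0 fun q =>
        if q = k then P (v k) else v q) := by
  rw [copy, ← map_add, kappaLin_apply, add_assoc]
  congr 2
  funext o
  cases o with
  | none => simp
  | some q =>
    rcases eq_or_ne q k with rfl | h <;> simp [*]

variable [FiniteDimensional ℂ H] {n : ℕ} (χ : OrthonormalBasis (Fin n) ℂ (LinearMap.range P))

theorem circ_one_left (k : ι) (ζ : Grassmann ι H) : circ A χ k 1 ζ = ζ := by
  rw [circ_eq_gaussIntegral A χ hA hP, map_one, one_mul]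
  induction ζ using CliffordAlgebra.left_induction with
  | algebraMap r =>
    rw [AlgHom.commutes, Algebra.algebraMap_eq_smul_one, gaussIntegral_smul,
      gaussIntegral_one χ hA hP, ← Algebra.algebraMap_eq_smul_one]
  | add x y hx hy => rw [map_add, gaussIntegral_add, hx, hy]
  | ι_mul x v hx =>
    have hmem : A (v k - P (v k)) ∈ LinearMap.range P :=
      ⟨A (v k), by rw [hP.apply_conj hA, map_sub]⟩
    have h := gaussIntegral_copy_none_conj_mul χ hA hP k hmem
      (ω := kappa P k none (some k) x) (fun y hy => by
        rw [kappa_eq_map, ExteriorAlgebra.contractLeft_map, (dualAt_comp_kappaLin hA hP k hy).2.2]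
        simp)
    rw [hA.involutive] at h
    rw [map_mul, kappa_eq_map, ExteriorAlgebra.map_apply_ι, ι_kappaLin_right, add_mul,
      gaussIntegral_add, ← kappa_eq_map, h, gaussIntegral_ι_mul A χ k (by rfl), hx, ← add_mul,
      copy, ← map_add]
    congr 2
    funext q
    rcases eq_or_ne q k with rfl | h <;> simp [*]

theorem circ_ι_mul (k : ι) (v : ι → H) (ξ ζ : Grassmann ι H) :
    circ A χ k (ExteriorAlgebra.ι ℂ v * ξ) ζ =
      ExteriorAlgebra.ι ℂ v * circ A χ k ξ ζ +
        circ A χ k (involute ξ) (contractLeft (contraction A P k v) ζ) := by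
  have hmem : P (v k) ∈ LinearMap.range P := ⟨_, rfl⟩
  simp only [circ_eq_gaussIntegral A χ hA hP]
  rw [map_mul, mul_assoc, kappa_eq_map, ExteriorAlgebra.map_apply_ι, ι_kappaLin_left, add_mul,
    gaussIntegral_add, gaussIntegral_copy_none_mul χ hA hP k hmem,
    gaussIntegral_ι_mul A χ k (by rfl), contractLeft_mul, ExteriorAlgebra.contractLeft_map,
    (dualAt_comp_kappaLin hA hP k hmem).1, map_zero, LinearMap.zero_apply, map_zero, zero_mul,
    zero_add, kappa_eq_map, ExteriorAlgebra.contractLeft_map,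
    (dualAt_comp_kappaLin hA hP k hmem).2.1, ← contraction_eq_dualAt,
    ExteriorAlgebra.involute_map, add_right_comm, ← add_mul, copy, ← map_add]
  congr 3
  funext q
  rcases eq_or_ne q k with rfl | h <;> simp [*]

theorem circ_add_left (k : ι) (ξ η ζ : Grassmann ι H) :
    circ A χ k (ξ + η) ζ = circ A χ k ξ ζ + circ A χ k η ζ := by
  simp only [circ_eq_gaussIntegral A χ hA hP, map_add, add_mul, gaussIntegral_add]

theorem circ_smul_left (k : ι) (r : ℂ) (ξ ζ : Grassmann ι H) :
    circ A χ k (r • ξ) ζ = r • circ A χ k ξ ζ := by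
  simp only [circ_eq_gaussIntegral A χ hA hP, map_smul, smul_mul_assoc, gaussIntegral_smul]

end Circle

end GrassmannWeyl

end

noncomputable section

namespace GrassmannWeyl

open CliffordAlgebra (contractLeft involute contractLeft_mul contractLeft_ι_mul changeForm
  changeForm_ι changeForm_ι_mul changeForm_one changeForm_contractLeft)

section Transport

variable {ι H : Type*} [NormedAddCommGroup H] [InnerProductSpace ℂ H]

variable (A : H →ₗ⋆[ℂ] H) (P : H →ₗ[ℂ] H) (k : ι)

/-- The quadratic form `v ↦ ⟨A P v_k, v_k⟩`, whose Clifford algebra is the Grassmann algebra with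
the circle product. -/
def contractionForm : QuadraticForm ℂ (ι → H) := (contraction A P k).toQuadraticMap

theorem contractionForm_proof :
    (contraction A P k).toQuadraticMap = contractionForm A P k - 0 := by
  rw [contractionForm, sub_zero]

/-- The identification of the Grassmann algebra with the Clifford algebra of `contractionForm`. -/
def toClifford : Grassmann ι H ≃ₗ[ℂ] CliffordAlgebra (contractionForm A P k) :=
  CliffordAlgebra.changeFormEquiv (contractionForm_proof A P k)

theorem toClifford_one : toClifford A P k 1 = 1 := changeForm_one (contractionForm_proof A P k)

theorem toClifford_ι (v : ι → H) :
    toClifford A P k (ExteriorAlgebra.ι ℂ v) = CliffordAlgebra.ι _ v := changeForm_ι (contractionForm_proof A P k) v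

theorem toClifford_ι_mul (v : ι → H) (x : Grassmann ι H) :
    toClifford A P k (ExteriorAlgebra.ι ℂ v * x) =
      CliffordAlgebra.ι _ v * toClifford A P k x -
        contractLeft (contraction A P k v) (toClifford A P k x) :=
  changeForm_ι_mul (contractionForm_proof A P k) v x

theorem toClifford_contractLeft (d : Module.Dual ℂ (ι → H)) (x : Grassmann ι H) :
    toClifford A P k (contractLeft d x) = contractLeft d (toClifford A P k x) :=
  changeForm_contractLeft (contractionForm_proof A P k) d x

theorem toClifford_involute (x : Grassmann ι H) :
    toClifford A P k (involute x) = involute (toClifford A P k x) := by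
  induction x using CliffordAlgebra.left_induction with
  | algebraMap r =>
    rw [AlgHom.commutes, Algebra.algebraMap_eq_smul_one, map_smul, toClifford_one, map_smul,
      map_one]
  | add x y hx hy => simp only [map_add, hx, hy]
  | ι_mul x v hx =>
    rw [toClifford_ι_mul, map_sub, map_mul involute, map_mul involute, CliffordAlgebra.involute_ι,
      CliffordAlgebra.involute_ι, neg_mul, map_neg, toClifford_ι_mul, hx,
      CliffordAlgebra.involute_contractLeft]
    noncomm_ring

end Transport

section Circle

variable {ι H : Type*} [Fintype ι] [DecidableEq ι] [NormedAddCommGroup H] [InnerProductSpace ℂ H]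
  [FiniteDimensional ℂ H] {A : H →ₗ⋆[ℂ] H} {P : H →ₗ[ℂ] H} {n : ℕ}
  (χ : OrthonormalBasis (Fin n) ℂ (LinearMap.range P)) (k : ι)
  (hA : IsSelfDual A) (hP : IsBasisProjection A P)
include hA hP

theorem toClifford_circ (ξ ζ : Grassmann ι H) :
    toClifford A P k (circ A χ k ξ ζ) = toClifford A P k ξ * toClifford A P k ζ := by
  suffices h : ∀ ζ : Grassmann ι H,
      toClifford A P k (circ A χ k ξ ζ) = toClifford A P k ξ * toClifford A P k ζ ∧
      toClifford A P k (circ A χ k (involute ξ) ζ) =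
        toClifford A P k (involute ξ) * toClifford A P k ζ from (h ζ).1
  clear ζ
  induction ξ using CliffordAlgebra.left_induction with
  | algebraMap r =>
    intro ζ
    rw [AlgHom.commutes, Algebra.algebraMap_eq_smul_one, circ_smul_left hA hP,
      circ_one_left hA hP, map_smul, map_smul, toClifford_one, smul_mul_assoc, one_mul]
    exact ⟨rfl, rfl⟩
  | add x y hx hy =>
    intro ζ
    rw [map_add involute, circ_add_left hA hP, circ_add_left hA hP]
    simp only [map_add, (hx ζ).1, (hx ζ).2, (hy ζ).1, (hy ζ).2, add_mul, and_self]
  | ι_mul x v hx =>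
    have key : ∀ y : Grassmann ι H, (∀ ζ, toClifford A P k (circ A χ k y ζ) =
          toClifford A P k y * toClifford A P k ζ) →
        (∀ ζ, toClifford A P k (circ A χ k (involute y) ζ) =
          toClifford A P k (involute y) * toClifford A P k ζ) → ∀ ζ,
        toClifford A P k (circ A χ k (ExteriorAlgebra.ι ℂ v * y) ζ) =
          toClifford A P k (ExteriorAlgebra.ι ℂ v * y) * toClifford A P k ζ := by
      intro y h1 h2 ζ
      rw [circ_ι_mul hA hP, map_add, toClifford_ι_mul, h1, h2, toClifford_ι_mul,
        toClifford_involute, toClifford_contractLeft, contractLeft_mul]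
      noncomm_ring
    intro ζ
    refine ⟨key x (fun ζ => (hx ζ).1) (fun ζ => (hx ζ).2) ζ, ?_⟩
    rw [map_mul involute, CliffordAlgebra.involute_ι, neg_mul, ← neg_one_smul ℂ, circ_smul_left hA hP,
      map_smul, map_smul, key (involute x) (fun ζ => (hx ζ).2) (fun ζ => by
      rw [CliffordAlgebra.involute_involute]; exact (hx ζ).1), smul_mul_assoc]

theorem toClifford_circ_iterate (x : Grassmann ι H) (r : ℕ) :
    toClifford A P k ((circ A χ k x)^[r] 1) = toClifford A P k x ^ r := by
  induction r with
  | zero => rw [Function.iterate_zero_apply, toClifford_one, pow_zero]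
  | succ r ih => rw [Function.iterate_succ_apply', toClifford_circ χ k hA hP, ih, pow_succ']

theorem circExp_eq_sum {x : Grassmann ι H} {N : ℕ} (h : toClifford A P k x ^ N = 0) :
    circExp A χ k x =
      ∑ r ∈ Finset.range N, ((r.factorial : ℂ)⁻¹) • (circ A χ k x)^[r] 1 :=
  expSeries_eq_sum fun r hr => (toClifford A P k).injective (by
    rw [toClifford_circ_iterate χ k hA hP, pow_eq_zero_of_le hr h, map_zero])

theorem toClifford_circExp {x : Grassmann ι H} (h : IsNilpotent (toClifford A P k x)) :
    toClifford A P k (circExp A χ k x) = nilExp (toClifford A P k x) := by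
  obtain ⟨N, h⟩ := h
  rw [circExp_eq_sum χ k hA hP h, nilExp_eq_sum h, map_sum]
  simp only [map_smul, toClifford_circ_iterate χ k hA hP]

end Circle

end GrassmannWeyl

end

noncomputable section

namespace GrassmannWeyl

open CliffordAlgebra (contractLeft involute contractLeft_mul contractLeft_ι_mul contractLeft_ι)

section Involution

variable {ι H : Type*} [NormedAddCommGroup H] [InnerProductSpace ℂ H] (A : H →ₗ⋆[ℂ] H)

/-- The involution as an algebra homomorphism into the conjugate opposite algebra. -/
def grassStarHom : Grassmann ι H →ₐ[ℂ] ConjOp (Grassmann ι H) :=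
  ExteriorAlgebra.lift ℂ ⟨starGen A, starGen_sq A⟩

theorem grassStar_one : grassStar A (1 : Grassmann ι H) = 1 :=
  congrArg (MulOpposite.unop (α := Grassmann ι H)) (map_one (grassStarHom A))

theorem grassStar_add (x y : Grassmann ι H) :
    grassStar A (x + y) = grassStar A x + grassStar A y :=
  congrArg (MulOpposite.unop (α := Grassmann ι H)) (map_add (grassStarHom A) x y)

theorem grassStar_mul (x y : Grassmann ι H) :
    grassStar A (x * y) = grassStar A y * grassStar A x :=
  congrArg (MulOpposite.unop (α := Grassmann ι H)) (map_mul (grassStarHom A) x y)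

theorem grassStar_smul (r : ℂ) (x : Grassmann ι H) :
    grassStar A (r • x) = starRingEnd ℂ r • grassStar A x := by
  have h : grassStarHom A (r • x) = algebraMap ℂ _ r * grassStarHom A x := by
    rw [map_smul, Algebra.smul_def]
  refine (congrArg (MulOpposite.unop (α := Grassmann ι H)) h).trans ?_
  rw [Algebra.smul_def, Algebra.commutes]
  rfl

theorem grassStar_ι (v : ι → H) :
    grassStar A (ExteriorAlgebra.ι ℂ v) = ExteriorAlgebra.ι ℂ fun q => A (v q) :=
  congrArg (MulOpposite.unop (α := Grassmann ι H)) 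
    (ExteriorAlgebra.lift_ι_apply (A := ConjOp (Grassmann ι H)) ℂ _ (starGen_sq A) v)

/-- The involution of the Grassmann algebra as an antilinear map. -/
def grassStarₗ : Grassmann ι H →ₗ⋆[ℂ] Grassmann ι H where
  toFun := grassStar A
  map_add' := grassStar_add A
  map_smul' := grassStar_smul A

theorem grassStarₗ_apply (x : Grassmann ι H) : grassStarₗ A x = grassStar A x := rfl

theorem grassStar_zero : grassStar A (0 : Grassmann ι H) = 0 := map_zero (grassStarₗ A)

theorem grassStar_neg (x : Grassmann ι H) : grassStar A (-x) = -grassStar A x :=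
  map_neg (grassStarₗ A) x

theorem grassStar_sub (x y : Grassmann ι H) :
    grassStar A (x - y) = grassStar A x - grassStar A y := map_sub (grassStarₗ A) x y

theorem grassStar_algebraMap (r : ℂ) :
    grassStar A (algebraMap ℂ (Grassmann ι H) r) = algebraMap ℂ _ (starRingEnd ℂ r) := by
  rw [Algebra.algebraMap_eq_smul_one, grassStar_smul, grassStar_one,
    ← Algebra.algebraMap_eq_smul_one]

theorem grassStar_copy [DecidableEq ι] (q : ι) (φ : H) :
    grassStar A (copy q φ) = copy q (A φ) := by
  rw [copy, grassStar_ι, copy]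
  congr 1
  funext p
  rcases eq_or_ne p q with rfl | h <;> simp [*]

theorem grassStar_involute (x : Grassmann ι H) :
    grassStar A (involute x) = involute (grassStar A x) := by
  induction x using CliffordAlgebra.left_induction with
  | algebraMap r => rw [AlgHom.commutes, grassStar_algebraMap, AlgHom.commutes]
  | add x y hx hy => rw [map_add, grassStar_add, hx, hy, grassStar_add, map_add]
  | ι_mul x v hx =>
    rw [map_mul, grassStar_mul, hx, CliffordAlgebra.involute_ι, grassStar_neg, grassStar_mul,
      map_mul, grassStar_ι, CliffordAlgebra.involute_ι]

variable {A} {P : H →ₗ[ℂ] H} (hA : IsSelfDual A) (hP : IsBasisProjection A P)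
include hA hP

theorem contraction_conj (k : ι) (v w : ι → H) :
    contraction A P k (fun q => A (w q)) (fun q => A (v q)) =
      starRingEnd ℂ (contraction A P k v w) := by
  rw [contraction_apply, contraction_apply, hP.conj_eq, inner_conj_symm, inner_sub_left,
    hP.inner_left, hP.apply_conj hA, inner_sub_right]
  abel

theorem contractLeft_grassStar (k : ι) (w : ι → H) (x : Grassmann ι H) :
    contractLeft (contraction A P k fun q => A (w q)) (grassStar A x) =
      -grassStar A (contractLeft (LinearMap.flip (contraction A P k) w) (involute x)) := by
  induction x using CliffordAlgebra.left_induction with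
  | algebraMap r =>
    rw [grassStar_algebraMap, AlgHom.commutes, CliffordAlgebra.contractLeft_algebraMap,
      CliffordAlgebra.contractLeft_algebraMap, grassStar_zero, neg_zero]
  | add x y hx hy =>
    rw [grassStar_add, map_add, hx, hy, map_add, map_add, grassStar_add]
    abel
  | ι_mul x v hx =>
    rw [grassStar_mul, contractLeft_mul, hx, map_mul, CliffordAlgebra.involute_ι, neg_mul, neg_mul,
      map_neg, contractLeft_ι_mul, grassStar_neg, neg_neg, grassStar_sub, grassStar_smul, grassStar_mul,
      grassStar_ι, contractLeft_ι, contraction_conj hA hP, grassStar_involute,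
      LinearMap.flip_apply, ← Algebra.commutes, ← Algebra.smul_def]
    noncomm_ring

end Involution

section Circle

variable {ι H : Type*} [Fintype ι] [DecidableEq ι] [NormedAddCommGroup H] [InnerProductSpace ℂ H]
  [FiniteDimensional ℂ H] {A : H →ₗ⋆[ℂ] H} {P : H →ₗ[ℂ] H} {n : ℕ}
  (χ : OrthonormalBasis (Fin n) ℂ (LinearMap.range P)) (k : ι)
  (hA : IsSelfDual A) (hP : IsBasisProjection A P)
include hA hP

theorem circ_one_right (x : Grassmann ι H) : circ A χ k x 1 = x :=
  (toClifford A P k).injective (by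
    rw [toClifford_circ χ k hA hP, toClifford_one, mul_one])

theorem circ_assoc (x y z : Grassmann ι H) :
    circ A χ k (circ A χ k x y) z = circ A χ k x (circ A χ k y z) :=
  (toClifford A P k).injective (by simp only [toClifford_circ χ k hA hP, mul_assoc])

theorem circ_add_right (x y z : Grassmann ι H) :
    circ A χ k x (y + z) = circ A χ k x y + circ A χ k x z :=
  (toClifford A P k).injective (by simp only [toClifford_circ χ k hA hP, map_add, mul_add])

theorem circ_smul_right (r : ℂ) (x y : Grassmann ι H) :
    circ A χ k x (r • y) = r • circ A χ k x y :=
  (toClifford A P k).injective (by simp only [toClifford_circ χ k hA hP, map_smul, mul_smul_comm])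

theorem circ_ι_left (w : ι → H) (x : Grassmann ι H) :
    circ A χ k (ExteriorAlgebra.ι ℂ w) x =
      ExteriorAlgebra.ι ℂ w * x + contractLeft (contraction A P k w) x := by
  have h := circ_ι_mul hA hP χ k w 1 x
  rwa [mul_one, map_one, circ_one_left hA hP, circ_one_left hA hP] at h

theorem circ_ι_right (x : Grassmann ι H) (w : ι → H) :
    circ A χ k x (ExteriorAlgebra.ι ℂ w) =
      x * ExteriorAlgebra.ι ℂ w - contractLeft (LinearMap.flip (contraction A P k) w) (involute x) := by
  induction x using CliffordAlgebra.left_induction with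
  | algebraMap r =>
    rw [AlgHom.commutes, CliffordAlgebra.contractLeft_algebraMap, sub_zero,
      Algebra.algebraMap_eq_smul_one, circ_smul_left hA hP, circ_one_left hA hP, smul_mul_assoc,
      one_mul]
  | add x y hx hy =>
    rw [circ_add_left hA hP, hx, hy, map_add, map_add, add_mul]
    abel
  | ι_mul x v hx =>
    rw [circ_ι_mul hA hP, hx, contractLeft_ι, Algebra.algebraMap_eq_smul_one,
      circ_smul_right χ k hA hP, circ_one_right χ k hA hP, map_mul, CliffordAlgebra.involute_ι,
      neg_mul, map_neg, contractLeft_ι_mul, LinearMap.flip_apply]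
    noncomm_ring

theorem grassStar_circ (x y : Grassmann ι H) :
    grassStar A (circ A χ k x y) = circ A χ k (grassStar A y) (grassStar A x) := by
  obtain ⟨Y, rfl⟩ := (toClifford A P k).symm.surjective y
  induction Y using CliffordAlgebra.left_induction generalizing x with
  | algebraMap r =>
    have h : (toClifford A P k).symm (algebraMap ℂ _ r) = r • 1 := by
      rw [LinearEquiv.symm_apply_eq, map_smul, toClifford_one, Algebra.algebraMap_eq_smul_one]
    rw [h, circ_smul_right χ k hA hP, circ_one_right χ k hA hP, grassStar_smul, grassStar_smul,
      grassStar_one, circ_smul_left hA hP, circ_one_left hA hP]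
  | add X Y hX hY =>
    rw [map_add, circ_add_right χ k hA hP, grassStar_add, hX, hY, grassStar_add,
      circ_add_left hA hP]
  | ι_mul Y w hY =>
    have h : (toClifford A P k).symm (CliffordAlgebra.ι _ w * Y) =
        circ A χ k (ExteriorAlgebra.ι ℂ w) ((toClifford A P k).symm Y) := by
      rw [LinearEquiv.symm_apply_eq, toClifford_circ χ k hA hP, toClifford_ι,
        LinearEquiv.apply_symm_apply]
    have hw : ∀ z : Grassmann ι H, grassStar A (circ A χ k z (ExteriorAlgebra.ι ℂ w)) =
        circ A χ k (grassStar A (ExteriorAlgebra.ι ℂ w)) (grassStar A z) := fun z => by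
      rw [circ_ι_right χ k hA hP, grassStar_sub, grassStar_mul, grassStar_ι,
        circ_ι_left χ k hA hP, contractLeft_grassStar hA hP, sub_eq_add_neg]
    have hw' : circ A χ k (grassStar A ((toClifford A P k).symm Y))
        (grassStar A (ExteriorAlgebra.ι ℂ w)) =
        grassStar A (circ A χ k (ExteriorAlgebra.ι ℂ w) ((toClifford A P k).symm Y)) :=
      (hY _).symm
    rw [h, ← circ_assoc χ k hA hP, hY, hw, ← circ_assoc χ k hA hP, hw']

theorem toClifford_grassStar_circExp {x : Grassmann ι H} (h : IsNilpotent (toClifford A P k x))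
    (hx : grassStar A x = -x) :
    toClifford A P k (grassStar A (circExp A χ k x)) = nilExp (-toClifford A P k x) := by
  have hp : ∀ r : ℕ, toClifford A P k (grassStar A ((circ A χ k x)^[r] 1)) =
      (-toClifford A P k x) ^ r := by
    intro r
    induction r with
    | zero => rw [Function.iterate_zero_apply, grassStar_one, toClifford_one, pow_zero]
    | succ r ih =>
      rw [Function.iterate_succ_apply', grassStar_circ χ k hA hP, toClifford_circ χ k hA hP, ih,
        hx, map_neg, pow_succ]
  obtain ⟨N, h⟩ := h
  rw [circExp_eq_sum χ k hA hP h, nilExp_eq_sum (N := N) (by rw [neg_pow, h, mul_zero]),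
    ← grassStarₗ_apply, map_sum, map_sum]
  refine Finset.sum_congr rfl fun r _ => ?_
  rw [grassStarₗ_apply, grassStar_smul, map_smul, hp]
  simp

end Circle

end GrassmannWeyl

end

noncomputable section

namespace GrassmannWeyl

section Generators

variable {ι H : Type*} [DecidableEq ι] [NormedAddCommGroup H] [InnerProductSpace ℂ H]

/-- The generator `φ^(a)` of the Clifford algebra. -/
def gen (A : H →ₗ⋆[ℂ] H) (P : H →ₗ[ℂ] H) (k a : ι) (φ : H) :
    CliffordAlgebra (contractionForm A P k) :=
  CliffordAlgebra.ι _ (Pi.single a φ)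

variable (A : H →ₗ⋆[ℂ] H) (P : H →ₗ[ℂ] H) {k : ι}

theorem toClifford_copy (a : ι) (φ : H) : toClifford A P k (copy a φ) = gen A P k a φ :=
  toClifford_ι A P k _

theorem toClifford_copy_mul_copy {a : ι} (ha : k ≠ a) (b : ι) (φ θ : H) :
    toClifford A P k (copy a φ * copy b θ) = gen A P k a φ * gen A P k b θ := by
  have h : contraction A P k (Pi.single a φ) = 0 := by
    ext; simp [contraction_eq_dualAt, Pi.single_eq_of_ne ha]
  rw [copy, toClifford_ι_mul, toClifford_copy, h, map_zero, LinearMap.zero_apply, sub_zero]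
  rfl

theorem gen_mul_gen_swap {a : ι} (ha : k ≠ a) (b : ι) (φ θ : H) :
    gen A P k a φ * gen A P k b θ = -(gen A P k b θ * gen A P k a φ) := by
  refine eq_neg_of_add_eq_zero_left ?_
  rw [gen, gen, CliffordAlgebra.ι_mul_ι_add_swap, contractionForm, LinearMap.BilinMap.polar_toQuadraticMap]
  simp [Pi.single_eq_of_ne ha]

theorem gen_mul_self {a : ι} (ha : k ≠ a) (φ : H) : gen A P k a φ * gen A P k a φ = 0 := by
  rw [gen, CliffordAlgebra.ι_sq_scalar, contractionForm]
  simp [Pi.single_eq_of_ne ha]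

theorem commute_gen_mul_gen {a : ι} (ha : k ≠ a) (b c : ι) (φ θ η : H) :
    Commute (gen A P k a φ) (gen A P k b θ * gen A P k c η) := by
  rw [Commute, SemiconjBy, ← mul_assoc, gen_mul_gen_swap A P ha, neg_mul, mul_assoc,
    gen_mul_gen_swap A P ha, mul_neg, neg_neg, mul_assoc]

theorem gen_mul_gen_sq {a b : ι} (ha : k ≠ a) (φ θ : H) :
    gen A P k a φ * gen A P k b θ * (gen A P k a φ * gen A P k b θ) = 0 := by
  rw [← mul_assoc, ← (commute_gen_mul_gen A P ha a b φ φ θ).eq, ← mul_assoc, gen_mul_self A P ha,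
    zero_mul, zero_mul]

theorem gen_mul_gen_nilpotent {a b : ι} (ha : k ≠ a) (φ θ : H) :
    IsNilpotent (gen A P k a φ * gen A P k b θ) :=
  ⟨2, by rw [sq, gen_mul_gen_sq A P ha]⟩

theorem commute_bivector_gen {a b : ι} (ha : k ≠ a) (hb : k ≠ b) (c : ι) (φ θ η : H) :
    Commute (gen A P k a φ * gen A P k b θ) (gen A P k c η) := by
  rw [Commute, SemiconjBy, mul_assoc, gen_mul_gen_swap A P hb, mul_neg, ← mul_assoc,
    gen_mul_gen_swap A P ha, neg_mul, neg_neg, mul_assoc]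

theorem gen_add (a : ι) (φ θ : H) : gen A P k a (φ + θ) = gen A P k a φ + gen A P k a θ := by
  simp [gen, Pi.single_add]

theorem gen_smul (a : ι) (r : ℂ) (φ : H) : gen A P k a (r • φ) = r • gen A P k a φ := by
  simp [gen, Pi.single_smul]

theorem gen_sum {κ : Type*} (a : ι) (s : Finset κ) (φ : κ → H) :
    gen A P k a (∑ i ∈ s, φ i) = ∑ i ∈ s, gen A P k a (φ i) :=
  map_sum (AddMonoidHom.mk' (gen A P k a) (gen_add A P a)) φ s

variable {A P} (hA : IsSelfDual A) (hP : IsBasisProjection A P)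
include hA hP

theorem gen_self_mul_gen_self (φ θ : H) : gen A P k k φ * gen A P k k θ =
    algebraMap ℂ _ (inner ℂ (A φ) θ) - gen A P k k θ * gen A P k k φ := by
  refine eq_sub_of_add_eq ?_
  rw [gen, gen, CliffordAlgebra.ι_mul_ι_add_swap, contractionForm,
    LinearMap.BilinMap.polar_toQuadraticMap, contraction_apply, contraction_apply]
  simp only [Pi.single_eq_same]
  have h1 : inner ℂ (A (P φ)) θ = inner ℂ (A φ) θ - inner ℂ (A φ) (P θ) := by
    rw [← inner_sub_right, ← hP.conj_eq θ, hA.inner_map, hP.inner_left,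
      ← hA.inner_map (P φ) (A θ), hA.involutive]
  have h2 : inner ℂ (A (P θ)) φ = inner ℂ (A φ) (P θ) := by
    rw [← hA.inner_map, hA.involutive]
  rw [h1, h2]
  ring_nf

theorem bivector_mul_gen {a : ι} (ha : k ≠ a) (φ θ η : H) :
    gen A P k a φ * gen A P k k θ * gen A P k k η =
      gen A P k k η * (gen A P k a φ * gen A P k k θ) +
        (inner ℂ (A θ) η : ℂ) • gen A P k a φ := by
  rw [mul_assoc, gen_self_mul_gen_self hA hP, mul_sub, ← mul_assoc, ← Algebra.commutes,
    ← Algebra.smul_def, ← mul_assoc, gen_mul_gen_swap A P ha k φ η]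
  noncomm_ring

theorem bivector_mul_bivector {a b : ι} (ha : k ≠ a) (hb : k ≠ b) (φ θ φ' θ' : H) :
    gen A P k a φ * gen A P k k θ * (gen A P k b φ' * gen A P k k θ') =
      gen A P k b φ' * gen A P k k θ' * (gen A P k a φ * gen A P k k θ) +
        gen A P k b φ' * ((inner ℂ (A θ) θ' : ℂ) • gen A P k a φ) := by
  rw [← mul_assoc, ← (commute_gen_mul_gen A P hb a k φ' φ θ).eq, mul_assoc,
    bivector_mul_gen hA hP ha, mul_add, ← mul_assoc]

end Generators

section Modes

variable {ι H : Type*} [DecidableEq ι] [NormedAddCommGroup H] [InnerProductSpace ℂ H]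

/-- The vector `(ψ_1, Aψ_1, …, ψ_n, Aψ_n)`. -/
def modeVec (A : H →ₗ⋆[ℂ] H) {P : H →ₗ[ℂ] H} {n : ℕ}
    (ψ : OrthonormalBasis (Fin n) ℂ (LinearMap.range P)) (p : Fin 2 × Fin n) : H :=
  ![(ψ p.2 : H), A (ψ p.2 : H)] p.1

variable {A : H →ₗ⋆[ℂ] H} {P : H →ₗ[ℂ] H} {n : ℕ}
  (ψ : OrthonormalBasis (Fin n) ℂ (LinearMap.range P)) {k l m : ι}

theorem modes_eq_copy [Fintype ι] (q : ι) (p : Fin 2 × Fin n) :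
    modes A ψ q p = copy q (modeVec A ψ p) := by
  obtain ⟨i, j⟩ := p
  fin_cases i <;> rfl

theorem modeVec_conj (hA : IsSelfDual A) (p : Fin 2 × Fin n) :
    A (modeVec A ψ p) = modeVec A ψ (p.1.rev, p.2) := by
  obtain ⟨i, j⟩ := p
  fin_cases i
  · rfl
  · exact hA.involutive _

theorem sum_modeVec_conj (hA : IsSelfDual A) {M : Type*} [AddCommMonoid M] (f : H → H → M) :
    ∑ p, f (modeVec A ψ p) (A (modeVec A ψ p)) = ∑ p, f (A (modeVec A ψ p)) (modeVec A ψ p) := by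
  refine Fintype.sum_equiv (Fin.revPerm.prodCongr (Equiv.refl _)) _ _ fun p => ?_
  have h : modeVec A ψ ((Fin.revPerm.prodCongr (Equiv.refl _)) p) = A (modeVec A ψ p) :=
    (modeVec_conj ψ hA p).symm
  rw [h, hA.involutive]

theorem pairing_modes [Fintype ι] (hA : IsSelfDual A) (x : Fin 2 × Fin n → Grassmann ι H) (q : ι) :
    pairing x (modes A ψ q) = ∑ p, x p * copy q (A (modeVec A ψ p)) := by
  rw [pairing, dotProduct]
  refine Finset.sum_congr rfl fun p _ => ?_
  congr 1
  rw [swapMatrix, Matrix.mulVec, dotProduct, Fintype.sum_prod_type]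
  simp only [Matrix.blockDiagonal_apply, modes_eq_copy, modeVec_conj ψ hA]
  obtain ⟨i, j⟩ := p
  fin_cases i <;> simp

theorem inner_modeVec (hA : IsSelfDual A) (hP : IsBasisProjection A P) (p q : Fin 2 × Fin n) :
    inner ℂ (modeVec A ψ p) (modeVec A ψ q) = if p = q then 1 else 0 := by
  obtain ⟨i, j⟩ := p
  obtain ⟨i', j'⟩ := q
  have h1 := hP.inner_conj_of_mem hA (ψ j).2 (ψ j').2
  have h2 := hP.inner_conj_left_of_mem hA (ψ j).2 (ψ j').2
  have h3 := hA.inner_map (ψ j : H) (ψ j')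
  fin_cases i <;> fin_cases i' <;>
    simp [modeVec, h1, h2, h3, inner_basis ψ, Prod.ext_iff, eq_comm]

variable (A k l m) in
/-- The image of `(ψ^(l), 𝒥 ψ^(m))` in the Clifford algebra. -/
def modePairing : CliffordAlgebra (contractionForm A P k) :=
  ∑ p, gen A P k l (modeVec A ψ p) * gen A P k m (A (modeVec A ψ p))

theorem toClifford_pairing [Fintype ι] (hA : IsSelfDual A) (hl : k ≠ l) :
    toClifford A P k (pairing (modes A ψ l) (modes A ψ m)) = modePairing A ψ k l m := by
  rw [pairing_modes ψ hA, map_sum]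
  refine Finset.sum_congr rfl fun p _ => ?_
  rw [modes_eq_copy, toClifford_copy_mul_copy A P hl]

theorem grassStar_pairing [Fintype ι] (hA : IsSelfDual A) (l m : ι) :
    grassStar A (pairing (modes A ψ l) (modes A ψ m)) = -pairing (modes A ψ l) (modes A ψ m) := by
  rw [pairing_modes ψ hA, ← grassStarₗ_apply, map_sum]
  simp only [grassStarₗ_apply, grassStar_mul, grassStar_copy, modes_eq_copy, hA.involutive]
  rw [sum_modeVec_conj ψ hA fun x y => copy l x * copy m y, ← Finset.sum_neg_distrib]
  exact Finset.sum_congr rfl fun p _ =>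
    eq_neg_of_add_eq_zero_left (ExteriorAlgebra.ι_add_mul_swap _ _)

variable (hA : IsSelfDual A) (hP : IsBasisProjection A P)

theorem isNilpotent_modePairing_of_ne (hl : k ≠ l) (hm : k ≠ m) :
    IsNilpotent (modePairing A ψ k l m) :=
  Commute.isNilpotent_sum (fun _ _ => gen_mul_gen_nilpotent A P hl _ _) fun _ _ _ _ =>
    (commute_bivector_gen A P hl hm _ _ _ _).mul_right (commute_bivector_gen A P hl hm _ _ _ _)

include hA hP

theorem isNilpotent_modePairing (hl : k ≠ l) : IsNilpotent (modePairing A ψ k l k) := by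
  rw [modePairing]
  induction (Finset.univ : Finset (Fin 2 × Fin n)) using Finset.induction_on with
  | empty => simp
  | insert p s hp ih =>
    rw [Finset.sum_insert hp]
    set φ : H := ∑ q ∈ s, (inner ℂ (A (A (modeVec A ψ q))) (A (modeVec A ψ p)) : ℂ) • modeVec A ψ q
    have hcomm : (∑ q ∈ s, gen A P k l (modeVec A ψ q) * gen A P k k (A (modeVec A ψ q))) *
        (gen A P k l (modeVec A ψ p) * gen A P k k (A (modeVec A ψ p))) =
        gen A P k l (modeVec A ψ p) * gen A P k k (A (modeVec A ψ p)) *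
          (∑ q ∈ s, gen A P k l (modeVec A ψ q) * gen A P k k (A (modeVec A ψ q))) +
        gen A P k l (modeVec A ψ p) * gen A P k l φ := by
      simp only [φ, Finset.sum_mul, Finset.mul_sum, gen_sum, gen_smul, ← Finset.sum_add_distrib]
      exact Finset.sum_congr rfl fun q _ => bivector_mul_bivector hA hP hl hl _ _ _ _
    have hc : ∀ x, Commute (gen A P k l x * gen A P k k (A x))
        (gen A P k l (modeVec A ψ p) * gen A P k l φ) := fun x =>
      ((commute_bivector_gen A P hl hl _ _ _ _).mul_right
        (commute_bivector_gen A P hl hl _ _ _ _)).symm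
    rw [add_comm]
    exact (nilExp_add_of_commutator ih (gen_mul_gen_nilpotent A P hl _ _)
      (gen_mul_gen_nilpotent A P hl _ _) hcomm (Commute.sum_left _ _ _ fun q _ => hc _)
      (hc _)).1

theorem modePairing_mul_gen (hl : k ≠ l) (p : Fin 2 × Fin n) :
    modePairing A ψ k l k * gen A P k k (modeVec A ψ p) =
      gen A P k k (modeVec A ψ p) * modePairing A ψ k l k + gen A P k l (modeVec A ψ p) := by
  rw [modePairing, Finset.sum_mul, Finset.mul_sum]
  simp only [bivector_mul_gen hA hP hl, Finset.sum_add_distrib, hA.involutive,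
    inner_modeVec ψ hA hP]
  simp

omit hA hP in
theorem commute_modePairing_gen (hm : k ≠ m) (φ : H) :
    Commute (modePairing A ψ k l k) (gen A P k m φ) :=
  Commute.sum_left _ _ _ fun _ _ => (commute_gen_mul_gen A P hm l k _ _ _).symm

theorem modePairing_mul_modePairing (hl : k ≠ l) (hm : k ≠ m) :
    modePairing A ψ k l k * modePairing A ψ k m k =
      modePairing A ψ k m k * modePairing A ψ k l k + -modePairing A ψ k l m := by
  conv_lhs => rw [modePairing.eq_1 (m := k) (l := m), Finset.mul_sum]
  have h : ∀ p, modePairing A ψ k l k *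
      (gen A P k m (modeVec A ψ p) * gen A P k k (A (modeVec A ψ p))) =
      gen A P k m (modeVec A ψ p) * gen A P k k (A (modeVec A ψ p)) * modePairing A ψ k l k -
        gen A P k l (A (modeVec A ψ p)) * gen A P k m (modeVec A ψ p) := fun p => by
    rw [← mul_assoc, (commute_modePairing_gen ψ hm _).eq, mul_assoc, modeVec_conj ψ hA,
      modePairing_mul_gen ψ hA hP hl, mul_add, ← mul_assoc, gen_mul_gen_swap A P hm l,
      sub_eq_add_neg]
  simp only [h, Finset.sum_sub_distrib, ← Finset.sum_mul]
  rw [← sum_modeVec_conj ψ hA fun x y => gen A P k l x * gen A P k m y, sub_eq_add_neg]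
  rfl

omit hA hP in
theorem commute_modePairing (hl : k ≠ l) (hm : k ≠ m) (q : ι) :
    Commute (modePairing A ψ k q k) (modePairing A ψ k l m) :=
  Commute.sum_right _ _ _ fun _ _ =>
    (commute_modePairing_gen ψ hl _).mul_right (commute_modePairing_gen ψ hm _)

end Modes

section Weyl

variable {ι H : Type*} [Fintype ι] [DecidableEq ι] [NormedAddCommGroup H] [InnerProductSpace ℂ H]
  [FiniteDimensional ℂ H] {A : H →ₗ⋆[ℂ] H} {P : H →ₗ[ℂ] H} {n : ℕ}
  (χ ψ : OrthonormalBasis (Fin n) ℂ (LinearMap.range P)) {k l m : ι}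
  (hA : IsSelfDual A) (hP : IsBasisProjection A P)
include hA hP

theorem toClifford_weyl (hl : k ≠ l) :
    toClifford A P k (weyl A χ ψ k (modes A ψ l)) = nilExp (-modePairing A ψ k l k) := by
  have h := toClifford_pairing (m := k) ψ hA hl
  rw [weyl, toClifford_circExp χ k hA hP, map_neg, h]
  rw [map_neg, h]
  exact (isNilpotent_modePairing ψ hA hP hl).neg

theorem toClifford_grassStar_weyl (hl : k ≠ l) :
    toClifford A P k (grassStar A (weyl A χ ψ k (modes A ψ l))) =
      nilExp (- -modePairing A ψ k l k) := by
  have h := toClifford_pairing (m := k) ψ hA hl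
  rw [weyl, toClifford_grassStar_circExp χ k hA hP, map_neg, h]
  · rw [map_neg, h]
    exact (isNilpotent_modePairing ψ hA hP hl).neg
  · rw [grassStar_neg, grassStar_pairing ψ hA]

/-- The displacement operators translate the generators. -/
theorem weyl_conj (hl : k ≠ l) (p : Fin 2 × Fin n) :
    circ A χ k (circ A χ k (grassStar A (weyl A χ ψ k (modes A ψ l))) (modes A ψ k p))
      (weyl A χ ψ k (modes A ψ l)) = modes A ψ k p + modes A ψ l p := by
  apply (toClifford A P k).injective
  rw [toClifford_circ χ k hA hP, toClifford_circ χ k hA hP, toClifford_weyl χ ψ hA hP hl,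
    toClifford_grassStar_weyl χ ψ hA hP hl, modes_eq_copy, modes_eq_copy, map_add, toClifford_copy,
    toClifford_copy]
  refine nilExp_conj (isNilpotent_modePairing ψ hA hP hl).neg ?_
    (commute_modePairing_gen ψ hl _).neg_left
  rw [neg_mul, modePairing_mul_gen ψ hA hP hl]
  noncomm_ring

/-- The Weyl relation for the displacement operators. -/
theorem weyl_add (hl : k ≠ l) (hm : k ≠ m) :
    weyl A χ ψ k (modes A ψ l + modes A ψ m) =
      circ A χ k (circ A χ k (weyl A χ ψ k (modes A ψ l)) (weyl A χ ψ k (modes A ψ m)))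
        (circExp A χ k ((1 / 2 : ℂ) • pairing (modes A ψ l) (modes A ψ m))) := by
  apply (toClifford A P k).injective
  have hadd : toClifford A P k (-pairing (modes A ψ l + modes A ψ m) (modes A ψ k)) =
      -modePairing A ψ k l k + -modePairing A ψ k m k := by
    rw [pairing, add_dotProduct, map_neg, map_add, ← pairing, ← pairing,
      toClifford_pairing ψ hA hl, toClifford_pairing ψ hA hm, neg_add]
  have hz : toClifford A P k ((1 / 2 : ℂ) • pairing (modes A ψ l) (modes A ψ m)) =
      -(1 / 2 : ℂ) • -modePairing A ψ k l m := by
    rw [map_smul, toClifford_pairing ψ hA hl, neg_smul_neg]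
  have hnz := isNilpotent_modePairing_of_ne (A := A) ψ hl hm
  obtain ⟨h1, h2⟩ := nilExp_add_of_commutator (isNilpotent_modePairing ψ hA hP hl).neg
    (isNilpotent_modePairing ψ hA hP hm).neg hnz.neg
    (by rw [neg_mul_neg, neg_mul_neg, modePairing_mul_modePairing ψ hA hP hl hm])
    (commute_modePairing ψ hl hm l).neg_left.neg_right
    (commute_modePairing ψ hl hm m).neg_left.neg_right
  rw [toClifford_circ χ k hA hP, toClifford_circ χ k hA hP, toClifford_weyl χ ψ hA hP hl,
    toClifford_weyl χ ψ hA hP hm, weyl, toClifford_circExp χ k hA hP (by rwa [hadd]), hadd, h2,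
    toClifford_circExp χ k hA hP (by rw [hz]; exact hnz.neg.smul _), hz]

end Weyl

end GrassmannWeyl

end

theorem mainTheorem5 {H : Type*} [NormedAddCommGroup H] [InnerProductSpace ℂ H]
    [FiniteDimensional ℂ H] (A : H →ₗ⋆[ℂ] H) (hA : GrassmannWeyl.IsSelfDual A)
    (P : H →ₗ[ℂ] H) (hP : GrassmannWeyl.IsBasisProjection A P) {n : ℕ}
    (χ ψ : OrthonormalBasis (Fin n) ℂ (LinearMap.range P)) {N : ℕ} (k l m : Fin (N + 1))
    (hkl : k ≠ l) (hkm : k ≠ m) :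
    (∀ i : Fin n,
      GrassmannWeyl.circ A χ k
          (GrassmannWeyl.circ A χ k
            (GrassmannWeyl.grassStar A
              (GrassmannWeyl.weyl A χ ψ k (GrassmannWeyl.modes A ψ l)))
            (GrassmannWeyl.copy k (ψ i : H)))
          (GrassmannWeyl.weyl A χ ψ k (GrassmannWeyl.modes A ψ l))
        = GrassmannWeyl.copy k (ψ i : H) + GrassmannWeyl.copy l (ψ i : H)) ∧
    (∀ i : Fin n,
      GrassmannWeyl.circ A χ k
          (GrassmannWeyl.circ A χ k
            (GrassmannWeyl.grassStar A
              (GrassmannWeyl.weyl A χ ψ k (GrassmannWeyl.modes A ψ l)))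
            (GrassmannWeyl.copy k (A (ψ i : H))))
          (GrassmannWeyl.weyl A χ ψ k (GrassmannWeyl.modes A ψ l))
        = GrassmannWeyl.copy k (A (ψ i : H)) + GrassmannWeyl.copy l (A (ψ i : H))) ∧
    ((fun p => GrassmannWeyl.circ A χ k
          (GrassmannWeyl.circ A χ k
            (GrassmannWeyl.grassStar A
              (GrassmannWeyl.weyl A χ ψ k (GrassmannWeyl.modes A ψ l)))
            (GrassmannWeyl.modes A ψ k p))
          (GrassmannWeyl.weyl A χ ψ k (GrassmannWeyl.modes A ψ l)))
        = GrassmannWeyl.modes A ψ k + GrassmannWeyl.modes A ψ l) ∧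
    GrassmannWeyl.weyl A χ ψ k (GrassmannWeyl.modes A ψ l + GrassmannWeyl.modes A ψ m)
      = GrassmannWeyl.circ A χ k
          (GrassmannWeyl.circ A χ k
            (GrassmannWeyl.weyl A χ ψ k (GrassmannWeyl.modes A ψ l))
            (GrassmannWeyl.weyl A χ ψ k (GrassmannWeyl.modes A ψ m)))
          (GrassmannWeyl.circExp A χ k
            ((1 / 2 : ℂ) • GrassmannWeyl.pairing (GrassmannWeyl.modes A ψ l)
              (GrassmannWeyl.modes A ψ m))) := by
  exact ⟨fun i => GrassmannWeyl.weyl_conj χ ψ hA hP hkl (0, i),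
    fun i => GrassmannWeyl.weyl_conj χ ψ hA hP hkl (1, i),
    funext fun p => GrassmannWeyl.weyl_conj χ ψ hA hP hkl p,
    GrassmannWeyl.weyl_add χ ψ hA hP hkl hkm⟩
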